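/- Consider the two-user Gaussian symmetric interference channel $y_1 = h_d x_1 + h_c x_2 + z_1$, $y_2 = h_d x_2 + h_c x_1 + z_2$, with real gains $h_d, h_c$, noises $z_1, z_2\sim\mathcal N(0,1)$ that are i.i.d. in time, independent of each other and of the transmitters, and power constraint $P \ge 0$. Put $\mathrm{SNR} = h_d^2P$ and $\mathrm{INR} = h_c^2P$. The transmitters cooperate over noiseless, secure links, one in each direction, each of rate $C_G \ge 0$ bits per channel use. A code of block length $N$ consists of independent messages $W_i$ ($i=1,2$), uniform on $\{1,\dots,M_i\}$; independent local randomness at the two transmitters; cooperative symbols $v_{ij,k}$ ($j\ne i$, $1\le k\le N$), each a function of $W_i$, the local randomness of transmitter $i$ and the symbols $v_{ji,l}$, $l<k$, with values in finite sets $\mathcal V_{ij,k}$ such that $\prod_{k=1}^N|\mathcal V_{ij,k}|\le 2^{NC_G}$; inputs $x_{i,k}$, each a function of $W_i$, the local randomness of transmitter $i$ and the symbols $v_{ji,l}$, $l\le k$, with $\frac1N\sum_{k=1}^N E[x_{i,k}^2]\le P$; and decoders giving $\hat W_i$ as a function of $y_i^N$. A real number $R$ is an achievable symmetric secrecy rate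 if for every $\varepsilon>0$ and all sufficiently large $N$ there is such a code with $\frac1N\log_2 M_i\ge R-\varepsilon$, $\Pr[\hat W_i\ne W_i]\le\varepsilon$ and $\frac1N I(W_i;y_j^N)\le\varepsilon$ for $i = 1,2$ and $j\neq i$ (weak secrecy). Then every achievable symmetric secrecy rate $R_s$ satisfies $$R_s \le \max_{|\rho|\le 1}\left[2C_G+\tfrac12\log_2\left(1+\frac{\mathrm{SNR}+\mathrm{SNR}^2(1-\rho^2)}{1+\mathrm{SNR}+\mathrm{INR}+2\rho\sqrt{\mathrm{SNR}\cdot\mathrm{INR}}}\right)\right].$$ -/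

import Mathlib

open MeasureTheory ProbabilityTheory Filter

/-- The mutual information `I(X; Y)` (in nats) of two random variables on `(Ω, μ)`: the
Kullback-Leibler divergence of the joint law from the product of the marginal laws. -/
noncomputable def mutualInfo {Ω α β : Type*} [MeasurableSpace Ω] [MeasurableSpace α]
    [MeasurableSpace β] (μ : Measure Ω) (X : Ω → α) (Y : Ω → β) : ENNReal :=
  InformationTheory.klDiv (μ.map (fun ω => (X ω, Y ω))) ((μ.map X).prod (μ.map Y))

/-- A code of block length `N` for the two-user interference channel with cooperating
transmitters. The users are indexed by `Fin 2`, and `i.rev` is the other user. -/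
structure ICCode (N : ℕ) where
  /-- number of messages of user `i` -/
  numMsg : Fin 2 → ℕ
  numMsg_pos : ∀ i, 0 < numMsg i
  /-- alphabet of the local randomness of transmitter `i` -/
  Rand : Fin 2 → Type
  [measRand : ∀ i, MeasurableSpace (Rand i)]
  /-- law of the local randomness of transmitter `i` -/
  randLaw : ∀ i, Measure (Rand i)
  [probRand : ∀ i, IsProbabilityMeasure (randLaw i)]
  /-- size of the alphabet of the symbol that transmitter `i` sends over its cooperative link
  at time `k` -/
  coopCard : Fin 2 → Fin N → ℕ
  /-- the cooperative symbol of transmitter `i` at time `k`, as a function of its message, its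
  local randomness and the cooperative symbols received strictly before time `k` -/
  coop : ∀ (i : Fin 2) (k : Fin N), Fin (numMsg i) → Rand i →
    (∀ l : {l : Fin N // l < k}, Fin (coopCard i.rev l.1)) → Fin (coopCard i k)
  measurable_coop : ∀ i k w h, Measurable (fun r => coop i k w r h)
  /-- the channel input of transmitter `i` at time `k`, as a function of its message, its local
  randomness and the cooperative symbols received up to time `k` -/
  enc : ∀ (i : Fin 2) (k : Fin N), Fin (numMsg i) → Rand i →
    (∀ l : {l : Fin N // l ≤ k}, Fin (coopCard i.rev l.1)) → ℝ
  measurable_enc : ∀ i k w h, Measurable (fun r => enc i k w r h)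
  /-- the decoder of receiver `i` -/
  dec : ∀ i : Fin 2, (Fin N → ℝ) → Fin (numMsg i)
  measurable_dec : ∀ i, Measurable (dec i)

namespace ICCode

attribute [instance] ICCode.measRand ICCode.probRand

variable {N : ℕ} (c : ICCode N)

/-- The sample space: messages, local randomness of the transmitters, receiver noises. -/
abbrev Sample : Type :=
  (∀ i : Fin 2, Fin (c.numMsg i)) × (∀ i : Fin 2, c.Rand i) × (Fin 2 → Fin N → ℝ)

/-- Uniform messages, local randomness and standard Gaussian noises, all independent. -/
noncomputable def prob : Measure c.Sample :=
  (Measure.pi (fun i : Fin 2 => uniformOn (Set.univ : Set (Fin (c.numMsg i))))).prod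
    ((Measure.pi c.randLaw).prod
      (Measure.pi (fun _ : Fin 2 => Measure.pi (fun _ : Fin N => gaussianReal 0 1))))

/-- The message of user `i`. -/
def msg (i : Fin 2) (ω : c.Sample) : Fin (c.numMsg i) := ω.1 i

/-- The symbol sent by transmitter `i` over its cooperative link at time `k`. -/
def coopSymbol (ω : c.Sample) (i : Fin 2) (k : Fin N) : Fin (c.coopCard i k) :=
  c.coop i k (ω.1 i) (ω.2.1 i) (fun l => coopSymbol ω i.rev l.1)
termination_by k
decreasing_by exact l.2

/-- The channel input of transmitter `i` at time `k`. -/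
def input (i : Fin 2) (k : Fin N) (ω : c.Sample) : ℝ :=
  c.enc i k (ω.1 i) (ω.2.1 i) (fun l => c.coopSymbol ω i.rev l.1)

/-- The output block at receiver `i`, for direct gain `hd` and cross gain `hc`. -/
def output (hd hc : ℝ) (i : Fin 2) (ω : c.Sample) : Fin N → ℝ :=
  fun k => hd * c.input i k ω + hc * c.input i.rev k ω + ω.2.2 i k

/-- The cooperative link of each transmitter carries at most `N * CG` bits per block. -/
def CoopRateLE (CG : ℝ) : Prop :=
  ∀ i, ((∏ k, c.coopCard i k : ℕ) : ℝ) ≤ (2 : ℝ) ^ (N * CG)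

/-- Average power constraint `(1 / N) ∑ₖ E[|xᵢ,ₖ|²] ≤ P` at both transmitters. -/
def PowerLE (P : ℝ) : Prop :=
  ∀ i, ∑ k, ∫⁻ ω, ENNReal.ofReal (c.input i k ω ^ 2) ∂c.prob ≤ ENNReal.ofReal (N * P)

/-- The probability that receiver `i` does not recover the message of user `i`. -/
noncomputable def errorProb (hd hc : ℝ) (i : Fin 2) : ℝ :=
  c.prob.real {ω | c.dec i (c.output hd hc i ω) ≠ c.msg i ω}

/-- The information leaked about the message of user `i` to the other receiver. -/
noncomputable def leakage (hd hc : ℝ) (i : Fin 2) : ENNReal :=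
  mutualInfo c.prob (c.msg i) (c.output hd hc i.rev)

end ICCode

/-- `R` (in bits per channel use) is an achievable symmetric secrecy rate, under weak secrecy, of
the Gaussian symmetric interference channel with gains `hd`, `hc`, power `P` and cooperative
links of capacity `CG` bits per channel use. -/
def IsAchievableSymmSecrecyRate (hd hc P CG R : ℝ) : Prop :=
  ∀ ε : ℝ, 0 < ε → ∀ᶠ N : ℕ in atTop, ∃ c : ICCode N,
    c.CoopRateLE CG ∧ c.PowerLE P ∧
    ∀ i : Fin 2, R - ε ≤ Real.logb 2 (c.numMsg i) / N ∧
      c.errorProb hd hc i ≤ ε ∧ c.leakage hd hc i ≤ ENNReal.ofReal (N * ε)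

/-!
Given the cooperative symbols `v`, the data of the two transmitters are independent, since the
fibres of `v` are rectangles. Hence receiver `1` decodes from `s = hd x₁ + z₁` and `v` as well as
from `y₁`: averaging its decoder over the interference leaves the success probability unchanged.

Guessing the message `W₁` from `s` alone, by a union bound over the unknown `v`, costs at most
`log |𝒱| ≤ 2 N CG`, so by Fano's inequality, in its Donsker-Varadhan form, it remains to bound the
divergence of the law of `(W₁, s)` from a product law. Compare `s` with `a y₂ + σ z`, for a fresh
noise `z`. As `a y₂ + σ z` depends on `W₁` through `y₂` only, the chain rule bounds the divergence
by `I(W₁; y₂)`, which is small by secrecy, plus that of `s` from `a y₂ + σ z`. The latter is at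
most `N log σ` once `σ²` is the mean square of `s - a y₂`. With the best `a`, this `σ²` is the
argument of the logarithm in the outer bound, `ρ` being up to sign the correlation coefficient of
`x₁` and `x₂` over the block.
-/

open InformationTheory

section KullbackLeibler

lemma mul_le_klFun_add_exp_sub_one {x : ℝ} (hx : 0 ≤ x) (g : ℝ) :
    x * g ≤ klFun x + Real.exp g - 1 := by
  rw [klFun_apply]
  rcases hx.eq_or_lt with rfl | hx
  · simp [Real.exp_nonneg]
  · have h := Real.add_one_le_exp (g - Real.log x)
    rw [Real.exp_sub, Real.exp_log hx, le_div_iff₀ hx] at h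
    linarith

variable {α : Type*} [MeasurableSpace α] {μ ν : Measure α}

lemma integral_le_toReal_klDiv_add_integral_exp [IsFiniteMeasure μ] [IsFiniteMeasure ν]
    (h : klDiv μ ν ≠ ⊤) {g : α → ℝ} (hg : Integrable g μ)
    (hexp : Integrable (fun x => Real.exp (g x)) ν) :
    ∫ x, g x ∂μ ≤ (klDiv μ ν).toReal + ∫ x, Real.exp (g x) ∂ν - ν.real Set.univ := by
  obtain ⟨hac, hllr⟩ := klDiv_ne_top_iff.1 h
  have hkl : Integrable (fun x => klFun (μ.rnDeriv ν x).toReal) ν :=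
    (integrable_klFun_rnDeriv_iff hac).2 hllr
  calc ∫ x, g x ∂μ = ∫ x, (μ.rnDeriv ν x).toReal * g x ∂ν := (integral_rnDeriv_smul hac).symm
    _ ≤ ∫ x, (klFun (μ.rnDeriv ν x).toReal + Real.exp (g x) - 1) ∂ν :=
        integral_mono ((integrable_rnDeriv_smul_iff hac).2 hg)
          ((hkl.add hexp).sub (integrable_const 1))
          fun x => mul_le_klFun_add_exp_sub_one ENNReal.toReal_nonneg (g x)
    _ = (klDiv μ ν).toReal + ∫ x, Real.exp (g x) ∂ν - ν.real Set.univ := by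
        rw [integral_sub (by exact hkl.add hexp) (integrable_const 1), integral_add hkl hexp,
          toReal_klDiv_eq_integral_klFun hac]
        simp

lemma klDiv_withDensity_exp_neg [IsProbabilityMeasure μ] {ℓ : α → ℝ} (hℓ : Integrable ℓ μ)
    [IsProbabilityMeasure (μ.withDensity fun x => ENNReal.ofReal (Real.exp (-ℓ x)))] :
    klDiv μ (μ.withDensity fun x => ENNReal.ofReal (Real.exp (-ℓ x))) =
      ENNReal.ofReal (∫ x, ℓ x ∂μ) := by
  set ν := μ.withDensity fun x => ENNReal.ofReal (Real.exp (-ℓ x))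
  have hdens : AEMeasurable (fun x => ENNReal.ofReal (Real.exp (-ℓ x))) μ :=
    (Real.measurable_exp.comp_aemeasurable hℓ.aemeasurable.neg).ennreal_ofReal
  have hac : μ ≪ ν := withDensity_absolutelyContinuous' hdens
    (ae_of_all _ fun x => (ENNReal.ofReal_pos.2 (Real.exp_pos _)).ne')
  have hllr : llr μ ν =ᵐ[μ] ℓ := by
    filter_upwards [neg_llr hac, Measure.rnDeriv_withDensity₀ μ hdens] with x hneg hdensity
    refine neg_injective (hneg.trans ?_)
    rw [llr, hdensity, ENNReal.toReal_ofReal (Real.exp_pos _).le, Real.log_exp]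
  have hint : Integrable (llr μ ν) μ := hℓ.congr hllr.symm
  rw [klDiv_of_ac_of_integrable hac hint, integral_congr_ae hllr]
  simp

end KullbackLeibler

section Fano

lemma exp_log_mul_le {M p : ℝ} (hM : 1 ≤ M) (hp0 : 0 ≤ p) (hp1 : p ≤ 1) :
    Real.exp (Real.log M * p) ≤ 1 + p * (M - 1) := by
  have h := rpow_one_add_le_one_add_mul_self (s := M - 1) (by linarith) hp0 hp1
  rwa [add_sub_cancel, Real.rpow_def_of_pos (by linarith)] at h

lemma integral_uniformOn_univ {α : Type*} [Fintype α] [MeasurableSpace α]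
    [MeasurableSingletonClass α] (f : α → ℝ) :
    ∫ w, f w ∂uniformOn Set.univ = (∑ w, f w) / Fintype.card α := by
  cases isEmpty_or_nonempty α
  · simp [Measure.eq_zero_of_isEmpty]
  rw [integral_fintype Integrable.of_finite, Finset.sum_div]
  refine Finset.sum_congr rfl fun w _ => ?_
  simp [measureReal_def, uniformOn_univ, div_eq_inv_mul]

variable {α 𝒱 : Type*} [Fintype α] [Fintype 𝒱]

/-- The score of the guess `w`, when `p w v` is the probability of guessing `w` from the side
information `v`. Averaging over `v` is the union bound over the unknown side information; it costs
`log (card 𝒱)` and makes the score independent of `v`. -/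
noncomputable def guessScore (p : α → 𝒱 → ℝ) (w : α) : ℝ :=
  Real.log ((∑ v, Real.exp (Real.log (Fintype.card α) * p w v)) / Fintype.card 𝒱)

lemma exp_guessScore [Nonempty 𝒱] (p : α → 𝒱 → ℝ) (w : α) :
    Real.exp (guessScore p w) =
      (∑ v, Real.exp (Real.log (Fintype.card α) * p w v)) / Fintype.card 𝒱 :=
  Real.exp_log (by positivity)

lemma log_card_mul_le_guessScore_add (p : α → 𝒱 → ℝ) (w : α) (v : 𝒱) :
    Real.log (Fintype.card α) * p w v ≤ guessScore p w + Real.log (Fintype.card 𝒱) := by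
  have : Nonempty 𝒱 := ⟨v⟩
  have hcard : (0 : ℝ) < Fintype.card 𝒱 := by positivity
  rw [← Real.exp_le_exp, Real.exp_add, exp_guessScore, Real.exp_log hcard,
    div_mul_cancel₀ _ hcard.ne']
  exact Finset.single_le_sum (f := fun v => Real.exp (Real.log (Fintype.card α) * p w v))
    (fun _ _ => (Real.exp_pos _).le) (Finset.mem_univ v)

lemma abs_guessScore_le [Nonempty 𝒱] {p : α → 𝒱 → ℝ} (hp0 : ∀ w v, 0 ≤ p w v)
    (hp1 : ∀ w v, p w v ≤ 1) (w : α) : |guessScore p w| ≤ Real.log (Fintype.card α) := by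
  have hlog : 0 ≤ Real.log (Fintype.card α) := Real.log_natCast_nonneg _
  have hcard : (0 : ℝ) < Fintype.card 𝒱 := by positivity
  have hlower : 0 ≤ guessScore p w := by
    rw [← Real.exp_le_exp, exp_guessScore, le_div_iff₀ hcard, Real.exp_zero, one_mul,
      ← nsmul_one, ← Finset.card_univ]
    exact Finset.card_nsmul_le_sum _ _ _ fun v _ => Real.one_le_exp (mul_nonneg hlog (hp0 w v))
  have hupper : guessScore p w ≤ Real.log (Fintype.card α) := by
    rw [← Real.exp_le_exp, exp_guessScore, div_le_iff₀ hcard, mul_comm, ← nsmul_eq_mul,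
      ← Finset.card_univ (α := 𝒱)]
    exact Finset.sum_le_card_nsmul _ _ _ fun v _ =>
      Real.exp_le_exp.2 (mul_le_of_le_one_right hlog (hp1 w v))
  rwa [abs_of_nonneg hlower]

lemma sum_exp_guessScore_le [Nonempty α] [Nonempty 𝒱] {p : α → 𝒱 → ℝ}
    (hp0 : ∀ w v, 0 ≤ p w v) (hp1 : ∀ w v, p w v ≤ 1) (hsum : ∀ v, ∑ w, p w v ≤ 1) :
    ∑ w, Real.exp (guessScore p w) ≤ 2 * Fintype.card α := by
  have hcard : (1 : ℝ) ≤ Fintype.card α := by exact_mod_cast Fintype.card_pos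
  have hexp : ∀ v, ∑ w, Real.exp (Real.log (Fintype.card α) * p w v) ≤ 2 * Fintype.card α := by
    intro v
    calc ∑ w, Real.exp (Real.log (Fintype.card α) * p w v)
        ≤ ∑ w, (1 + p w v * (Fintype.card α - 1)) :=
          Finset.sum_le_sum fun w _ => exp_log_mul_le hcard (hp0 w v) (hp1 w v)
      _ = Fintype.card α + (∑ w, p w v) * (Fintype.card α - 1) := by
          simp [Finset.sum_add_distrib, Finset.sum_mul]
      _ ≤ 2 * Fintype.card α := by
          linarith [mul_le_of_le_one_left (sub_nonneg.2 hcard) (hsum v)]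
  simp_rw [exp_guessScore]
  rw [← Finset.sum_div, Finset.sum_comm, div_le_iff₀ (by positivity), mul_comm, ← nsmul_eq_mul,
    ← Finset.card_univ (α := 𝒱)]
  exact Finset.sum_le_card_nsmul _ _ _ fun v _ => hexp v

variable {Ω : Type*} [MeasurableSpace Ω]

lemma log_card_mul_integral_le_integral_guessScore_add {P : Measure Ω} [IsProbabilityMeasure P]
    {W : Ω → α} {V : Ω → 𝒱} {p : Ω → α → 𝒱 → ℝ} (hp0 : ∀ ω w v, 0 ≤ p ω w v)
    (hint : Integrable (fun ω => guessScore (p ω) (W ω)) P) :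
    Real.log (Fintype.card α) * ∫ ω, p ω (W ω) (V ω) ∂P ≤
      ∫ ω, guessScore (p ω) (W ω) ∂P + Real.log (Fintype.card 𝒱) :=
  calc Real.log (Fintype.card α) * ∫ ω, p ω (W ω) (V ω) ∂P
      = ∫ ω, Real.log (Fintype.card α) * p ω (W ω) (V ω) ∂P := (integral_const_mul _ _).symm
    _ ≤ ∫ ω, (guessScore (p ω) (W ω) + Real.log (Fintype.card 𝒱)) ∂P :=
        integral_mono_of_nonneg
          (ae_of_all _ fun ω => mul_nonneg (Real.log_natCast_nonneg _) (hp0 _ _ _))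
          (hint.add (integrable_const _))
          (ae_of_all _ fun ω => log_card_mul_le_guessScore_add (p ω) (W ω) (V ω))
    _ = ∫ ω, guessScore (p ω) (W ω) ∂P + Real.log (Fintype.card 𝒱) := by
        rw [integral_add hint (integrable_const _)]
        simp

variable {𝒮 : Type*} [MeasurableSpace 𝒮] [MeasurableSpace α] [MeasurableSingletonClass α]

lemma measurable_guessScore {q : 𝒮 → α → 𝒱 → ℝ} (hq : ∀ w v, Measurable fun s => q s w v) :
    Measurable fun p : α × 𝒮 => guessScore (q p.2) p.1 :=
  measurable_from_prod_countable_right fun w => by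
    change Measurable fun s => guessScore (q s) w
    unfold guessScore
    fun_prop

lemma integral_exp_guessScore_le [Nonempty α] [Nonempty 𝒱] {q : 𝒮 → α → 𝒱 → ℝ}
    (hq0 : ∀ s w v, 0 ≤ q s w v) (hq1 : ∀ s w v, q s w v ≤ 1) (hsum : ∀ s v, ∑ w, q s w v ≤ 1)
    {θ : Measure 𝒮} [IsProbabilityMeasure θ]
    (hint : Integrable (fun p : α × 𝒮 => Real.exp (guessScore (q p.2) p.1))
      ((uniformOn Set.univ).prod θ)) :
    ∫ p : α × 𝒮, Real.exp (guessScore (q p.2) p.1) ∂(uniformOn Set.univ).prod θ ≤ 2 := by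
  have hcard : (0 : ℝ) < Fintype.card α := by positivity
  calc ∫ p : α × 𝒮, Real.exp (guessScore (q p.2) p.1) ∂(uniformOn Set.univ).prod θ
      = ∫ s, (∑ w, Real.exp (guessScore (q s) w)) / Fintype.card α ∂θ := by
        rw [integral_prod_symm _ hint]
        simp_rw [integral_uniformOn_univ]
    _ ≤ ∫ _, 2 ∂θ := by
        refine integral_mono_of_nonneg (ae_of_all _ fun s => by positivity) (integrable_const 2)
          (ae_of_all _ fun s => ?_)
        exact (div_le_iff₀ hcard).2 (sum_exp_guessScore_le (hq0 s) (hq1 s) (hsum s))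
    _ = 2 := by simp

lemma integrable_guessScore [Nonempty 𝒱] {q : 𝒮 → α → 𝒱 → ℝ}
    (hq : ∀ w v, Measurable fun s => q s w v) (hq0 : ∀ s w v, 0 ≤ q s w v)
    (hq1 : ∀ s w v, q s w v ≤ 1) (ρ : Measure (α × 𝒮)) [IsFiniteMeasure ρ] :
    Integrable (fun p : α × 𝒮 => guessScore (q p.2) p.1) ρ :=
  .of_bound (measurable_guessScore hq).aestronglyMeasurable _
    (ae_of_all _ fun p => abs_guessScore_le (hq0 p.2) (hq1 p.2) p.1)

lemma integrable_exp_guessScore [Nonempty 𝒱] {q : 𝒮 → α → 𝒱 → ℝ}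
    (hq : ∀ w v, Measurable fun s => q s w v) (hq0 : ∀ s w v, 0 ≤ q s w v)
    (hq1 : ∀ s w v, q s w v ≤ 1) (ρ : Measure (α × 𝒮)) [IsFiniteMeasure ρ] :
    Integrable (fun p : α × 𝒮 => Real.exp (guessScore (q p.2) p.1)) ρ :=
  .of_bound (measurable_guessScore hq).exp.aestronglyMeasurable
    (Real.exp (Real.log (Fintype.card α))) (ae_of_all _ fun p => by
      rw [Real.norm_eq_abs, Real.abs_exp]
      exact Real.exp_le_exp.2 (le_of_abs_le (abs_guessScore_le (hq0 p.2) (hq1 p.2) p.1)))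

theorem log_card_mul_integral_le_toReal_klDiv [Nonempty α]
    {P : Measure Ω} [IsProbabilityMeasure P] {W : Ω → α} {V : Ω → 𝒱} {S : Ω → 𝒮}
    (hW : Measurable W) (hS : Measurable S)
    {q : 𝒮 → α → 𝒱 → ℝ} (hq : ∀ w v, Measurable fun s => q s w v)
    (hq0 : ∀ s w v, 0 ≤ q s w v) (hsum : ∀ s v, ∑ w, q s w v ≤ 1)
    {θ : Measure 𝒮} [IsProbabilityMeasure θ]
    (hfin : klDiv (P.map fun ω => (W ω, S ω)) ((uniformOn Set.univ).prod θ) ≠ ⊤) :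
    Real.log (Fintype.card α) * ∫ ω, q (S ω) (W ω) (V ω) ∂P ≤
      (klDiv (P.map fun ω => (W ω, S ω)) ((uniformOn Set.univ).prod θ)).toReal +
        Real.log (Fintype.card 𝒱) + 1 := by
  have : Nonempty 𝒱 := (nonempty_of_isProbabilityMeasure P).map V
  have hWS : Measurable fun ω => (W ω, S ω) := hW.prodMk hS
  have := Measure.isProbabilityMeasure_map (μ := P) hWS.aemeasurable
  have hq1 : ∀ s w v, q s w v ≤ 1 := fun s w v =>
    (Finset.single_le_sum (fun w _ => hq0 s w v) (Finset.mem_univ w)).trans (hsum s v)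
  have hint := integrable_guessScore hq hq0 hq1 (P.map fun ω => (W ω, S ω))
  have hexp := integrable_exp_guessScore hq hq0 hq1 ((uniformOn Set.univ).prod θ)
  have hguess := log_card_mul_integral_le_integral_guessScore_add (V := V)
    (fun ω => hq0 (S ω)) (hint.comp_measurable hWS)
  have hdv := integral_le_toReal_klDiv_add_integral_exp hfin hint hexp
  have hmean := integral_exp_guessScore_le hq0 hq1 hsum hexp
  rw [integral_map hWS.aemeasurable hint.aestronglyMeasurable, probReal_univ] at hdv
  linarith

end Fano

section Measure

lemma pi_withDensity {ι : Type*} [Fintype ι] {α : ι → Type*} [∀ i, MeasurableSpace (α i)]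
    (μ : ∀ i, Measure (α i)) [∀ i, IsProbabilityMeasure (μ i)] {d : ∀ i, α i → ENNReal}
    (hd : ∀ i, Measurable (d i)) [∀ i, SigmaFinite ((μ i).withDensity (d i))] :
    Measure.pi (fun i => (μ i).withDensity (d i)) =
      (Measure.pi μ).withDensity fun x => ∏ i, d i (x i) := by
  classical
  refine Measure.pi_eq fun s hs => ?_
  have hm : ∀ i, Measurable ((s i).indicator (d i)) := fun i => (hd i).indicator (hs i)
  have hind : ∀ x : ∀ i, α i, (Set.univ.pi s).indicator (fun x => ∏ i, d i (x i)) x =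
      ∏ i, (s i).indicator (d i) (x i) := by
    intro x
    simp only [Set.indicator_apply, Set.mem_univ_pi, Finset.prod_ite_zero, Finset.mem_univ,
      forall_const]
  calc (Measure.pi μ).withDensity (fun x => ∏ i, d i (x i)) (Set.univ.pi s)
      = ∫⁻ x, ∏ i, (s i).indicator (d i) (x i) ∂Measure.pi μ := by
        rw [withDensity_apply _ (.univ_pi hs), ← lintegral_indicator (.univ_pi hs)]
        simp_rw [hind]
    _ = ∏ i, ∫⁻ x, (s i).indicator (d i) (x i) ∂Measure.pi μ :=
        lintegral_prod_eq_prod_lintegral_of_indepFun Finset.univ _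
          (iIndepFun_pi fun i => (hm i).aemeasurable) fun i => (hm i).comp (measurable_pi_apply i)
    _ = ∏ i, (μ i).withDensity (d i) (s i) := by
        refine Finset.prod_congr rfl fun i _ => ?_
        rw [(measurePreserving_eval μ i).lintegral_comp (hm i), lintegral_indicator (hs i),
          withDensity_apply _ (hs i)]

lemma integral_prod_add_sq {α β : Type*} [MeasurableSpace α] [MeasurableSpace β] {μ : Measure α}
    {ν : Measure β} [IsProbabilityMeasure μ] [IsProbabilityMeasure ν] {f : α → ℝ} {g : β → ℝ}
    (hf : MemLp f 2 μ) (hg : MemLp g 2 ν) (hg0 : ∫ y, g y ∂ν = 0) :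
    ∫ p, (f p.1 + g p.2) ^ 2 ∂μ.prod ν = ∫ x, f x ^ 2 ∂μ + ∫ y, g y ^ 2 ∂ν := by
  have hf' : MemLp (fun p : α × β => f p.1) 2 (μ.prod ν) :=
    hf.comp_measurePreserving measurePreserving_fst
  have hg' : MemLp (fun p : α × β => g p.2) 2 (μ.prod ν) :=
    hg.comp_measurePreserving measurePreserving_snd
  have hfg : Integrable (fun p : α × β => f p.1 * g p.2) (μ.prod ν) := hf'.integrable_mul hg'
  have hexpand : ∀ p : α × β,
      (f p.1 + g p.2) ^ 2 = f p.1 ^ 2 + 2 * (f p.1 * g p.2) + g p.2 ^ 2 := fun p => by ring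
  simp_rw [hexpand]
  rw [integral_add (by exact hf'.integrable_sq.add (hfg.const_mul 2)) hg'.integrable_sq,
    integral_add hf'.integrable_sq (hfg.const_mul 2), integral_const_mul, integral_prod_mul,
    hg0, integral_fun_fst (f := fun x => f x ^ 2), integral_fun_snd (f := fun y => g y ^ 2)]
  simp

end Measure

section Gaussian

/-- The log-likelihood ratio, at the observation `s`, of the Gaussian laws with means `x`, `y` and
variances `1`, `σ ^ 2`. -/
noncomputable def gaussianLLR (σ x y s : ℝ) : ℝ :=
  Real.log σ + (s - y) ^ 2 / (2 * σ ^ 2) - (s - x) ^ 2 / 2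

lemma gaussianReal_withDensity_exp_neg_gaussianLLR {σ : ℝ} (hσ : 0 < σ) (x y : ℝ) :
    (gaussianReal x 1).withDensity (fun s => ENNReal.ofReal (Real.exp (-gaussianLLR σ x y s))) =
      gaussianReal y (σ ^ 2).toNNReal := by
  have hvar : (σ ^ 2).toNNReal ≠ 0 := (Real.toNNReal_pos.2 (pow_pos hσ 2)).ne'
  rw [gaussianReal_of_var_ne_zero _ one_ne_zero, gaussianReal_of_var_ne_zero _ hvar,
    ← withDensity_mul _ (by fun_prop) (by unfold gaussianLLR; fun_prop)]
  congr 1 with s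
  have hexp : Real.exp (-gaussianLLR σ x y s) =
      σ⁻¹ * Real.exp ((s - x) ^ 2 / 2) * Real.exp (-(s - y) ^ 2 / (2 * σ ^ 2)) := by
    nth_rw 2 [← Real.exp_log hσ]
    rw [← Real.exp_neg, ← Real.exp_add, ← Real.exp_add, gaussianLLR]
    ring_nf
  rw [Pi.mul_apply, gaussianPDF, gaussianPDF, ← ENNReal.ofReal_mul (gaussianPDFReal_nonneg _ _ _),
    hexp, gaussianPDFReal, gaussianPDFReal, Real.coe_toNNReal _ (sq_nonneg σ), NNReal.coe_one,
    mul_one, mul_one, Real.sqrt_mul (by positivity) (σ ^ 2), Real.sqrt_sq hσ.le, neg_div (2 : ℝ),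
    Real.exp_neg]
  congr 1
  field_simp

variable {ι : Type*} [Fintype ι]

lemma pi_gaussianReal_withDensity_exp_neg_sum_gaussianLLR {σ : ℝ} (hσ : 0 < σ) (x y : ι → ℝ) :
    (Measure.pi fun k => gaussianReal (x k) 1).withDensity
        (fun s => ENNReal.ofReal (Real.exp (-∑ k, gaussianLLR σ (x k) (y k) (s k)))) =
      Measure.pi fun k => gaussianReal (y k) (σ ^ 2).toNNReal := by
  have hm : ∀ k, Measurable fun s => ENNReal.ofReal (Real.exp (-gaussianLLR σ (x k) (y k) s)) :=
    fun k => by unfold gaussianLLR; fun_prop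
  have hprod : ∀ s : ι → ℝ, ENNReal.ofReal (Real.exp (-∑ k, gaussianLLR σ (x k) (y k) (s k))) =
      ∏ k, ENNReal.ofReal (Real.exp (-gaussianLLR σ (x k) (y k) (s k))) := fun s => by
    rw [← ENNReal.ofReal_prod_of_nonneg fun _ _ => (Real.exp_pos _).le, ← Real.exp_sum,
      Finset.sum_neg_distrib]
  have : ∀ k, IsProbabilityMeasure ((gaussianReal (x k) 1).withDensity
      fun s => ENNReal.ofReal (Real.exp (-gaussianLLR σ (x k) (y k) s))) := fun k => by
    rw [gaussianReal_withDensity_exp_neg_gaussianLLR hσ]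
    infer_instance
  simp_rw [hprod, ← pi_withDensity (fun k => gaussianReal (x k) 1) hm,
    gaussianReal_withDensity_exp_neg_gaussianLLR hσ]

/-- The law of a vector of independent standard Gaussian variables, the noise of a block. -/
noncomputable abbrev stdNoise (ι : Type*) [Fintype ι] : Measure (ι → ℝ) :=
  Measure.pi fun _ => gaussianReal 0 1

lemma stdNoise_map_add_smul (σ : ℝ) (y : ι → ℝ) :
    (stdNoise ι).map (fun z => y + σ • z) =
      Measure.pi fun k => gaussianReal (y k) (σ ^ 2).toNNReal := by
  have haffine : ∀ k, (gaussianReal 0 1).map (fun z => y k + σ * z) =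
      gaussianReal (y k) (σ ^ 2).toNNReal := by
    intro k
    rw [show (fun z => y k + σ * z) = (y k + ·) ∘ (σ * ·) from rfl,
      ← Measure.map_map (by fun_prop) (by fun_prop), gaussianReal_map_const_mul,
      gaussianReal_map_const_add]
    congr 1
    · simp
    · ext; simp [sq_nonneg]
  simp_rw [← haffine]
  exact Measure.pi_map_pi (f := fun k z => y k + σ * z) fun k => by fun_prop

lemma memLp_eval_stdNoise (k : ι) : MemLp (fun z => z k) 2 (stdNoise ι) :=
  (memLp_id_gaussianReal 2).comp_measurePreserving
    (measurePreserving_eval (fun _ : ι => gaussianReal 0 1) k)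

lemma integral_eval_stdNoise (k : ι) : ∫ z, z k ∂stdNoise ι = 0 := by
  rw [integral_comp_eval (μ := fun _ : ι => gaussianReal 0 1) (f := fun x : ℝ => x) (by fun_prop)]
  exact integral_id_gaussianReal

lemma integral_eval_sq_stdNoise (k : ι) : ∫ z, z k ^ 2 ∂stdNoise ι = 1 := by
  have hvar := variance_fun_id_gaussianReal (μ := 0) (v := 1)
  rw [variance_eq_integral (by fun_prop)] at hvar
  rw [integral_comp_eval (μ := fun _ : ι => gaussianReal 0 1) (f := fun x => x ^ 2) (by fun_prop)]
  simpa using hvar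

lemma memLp_prod_add_mul_stdNoise {Ω : Type*} [MeasurableSpace Ω] {μ : Measure Ω}
    [IsProbabilityMeasure μ] {f : Ω → ℝ} (hf : MemLp f 2 μ) (b : ℝ) (k : ι) :
    MemLp (fun p : Ω × (ι → ℝ) => f p.1 + b * p.2 k) 2 (μ.prod (stdNoise ι)) :=
  (hf.comp_measurePreserving measurePreserving_fst).add
    (((memLp_eval_stdNoise k).const_mul b).comp_measurePreserving measurePreserving_snd)

lemma integral_prod_add_mul_stdNoise_sq {Ω : Type*} [MeasurableSpace Ω] {μ : Measure Ω}
    [IsProbabilityMeasure μ] {f : Ω → ℝ} (hf : MemLp f 2 μ) (b : ℝ) (k : ι) :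
    ∫ p : Ω × (ι → ℝ), (f p.1 + b * p.2 k) ^ 2 ∂μ.prod (stdNoise ι) =
      ∫ ω, f ω ^ 2 ∂μ + b ^ 2 := by
  rw [integral_prod_add_sq (g := fun z : ι → ℝ => b * z k) hf
    ((memLp_eval_stdNoise k).const_mul b) (by rw [integral_const_mul, integral_eval_stdNoise,
    mul_zero])]
  simp_rw [mul_pow]
  rw [integral_const_mul, integral_eval_sq_stdNoise, mul_one]

end Gaussian

section GaussianChannel

variable {ι Ω : Type*} [MeasurableSpace Ω] {μ : Measure Ω} {m : Ω → ι → ℝ}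

lemma measurable_channel (hm : Measurable m) (σ : ℝ) :
    Measurable fun p : Ω × (ι → ℝ) => (p.1, m p.1 + σ • p.2) :=
  measurable_fst.prodMk ((hm.comp measurable_fst).add (measurable_snd.const_smul σ))

variable [Fintype ι]

/-- The joint law of `ω`, distributed according to `μ`, and the output of the Gaussian channel with
input `m ω` and noise amplitude `σ`. -/
noncomputable def gaussianChannelLaw (μ : Measure Ω) (m : Ω → ι → ℝ) (σ : ℝ) :
    Measure (Ω × (ι → ℝ)) :=
  (μ.prod (stdNoise ι)).map fun p => (p.1, m p.1 + σ • p.2)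

lemma isProbabilityMeasure_gaussianChannelLaw [IsProbabilityMeasure μ] (hm : Measurable m) (σ : ℝ) :
    IsProbabilityMeasure (gaussianChannelLaw μ m σ) :=
  Measure.isProbabilityMeasure_map (measurable_channel hm σ).aemeasurable

lemma lintegral_gaussianChannelLaw [SFinite μ] (hm : Measurable m) (σ : ℝ)
    {F : Ω × (ι → ℝ) → ENNReal} (hF : Measurable F) :
    ∫⁻ p, F p ∂gaussianChannelLaw μ m σ =
      ∫⁻ ω, ∫⁻ s, F (ω, s) ∂Measure.pi (fun k => gaussianReal (m ω k) (σ ^ 2).toNNReal) ∂μ := by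
  have hchannel := measurable_channel hm σ
  rw [gaussianChannelLaw, lintegral_map hF hchannel, lintegral_prod _ (by fun_prop)]
  refine lintegral_congr fun ω => ?_
  rw [← stdNoise_map_add_smul, lintegral_map (by fun_prop) (by fun_prop)]

variable {X Y : Ω → ι → ℝ} [IsProbabilityMeasure μ]

lemma gaussianChannelLaw_withDensity_exp_neg_sum_gaussianLLR {σ : ℝ} (hσ : 0 < σ)
    (hX : Measurable X) (hY : Measurable Y) :
    (gaussianChannelLaw μ X 1).withDensity (fun p => ENNReal.ofReal
        (Real.exp (-∑ k, gaussianLLR σ (X p.1 k) (Y p.1 k) (p.2 k)))) =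
      gaussianChannelLaw μ Y σ := by
  have hdens : Measurable fun p : Ω × (ι → ℝ) => ENNReal.ofReal
      (Real.exp (-∑ k, gaussianLLR σ (X p.1 k) (Y p.1 k) (p.2 k))) := by
    unfold gaussianLLR
    fun_prop
  refine Measure.ext_of_lintegral _ fun F hF => ?_
  rw [lintegral_withDensity_eq_lintegral_mul _ hdens hF,
    lintegral_gaussianChannelLaw hX 1 (hdens.mul hF), lintegral_gaussianChannelLaw hY σ hF]
  refine lintegral_congr fun ω => ?_
  have hdensω : Measurable fun s : ι → ℝ =>
      ENNReal.ofReal (Real.exp (-∑ k, gaussianLLR σ (X ω k) (Y ω k) (s k))) := by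
    unfold gaussianLLR
    fun_prop
  have hFω : Measurable fun s => F (ω, s) := by fun_prop
  rw [← pi_gaussianReal_withDensity_exp_neg_sum_gaussianLLR hσ (X ω),
    lintegral_withDensity_eq_lintegral_mul _ hdensω hFω, one_pow, Real.toNNReal_one]
  simp only [Pi.mul_apply]

lemma integral_gaussianLLR_channel {σ : ℝ} {k : ι}
    (hXY : MemLp (fun ω => X ω k - Y ω k) 2 μ) :
    Integrable (fun p : Ω × (ι → ℝ) => gaussianLLR σ (X p.1 k) (Y p.1 k) (X p.1 k + p.2 k))
        (μ.prod (stdNoise ι)) ∧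
      ∫ p : Ω × (ι → ℝ), gaussianLLR σ (X p.1 k) (Y p.1 k) (X p.1 k + p.2 k)
          ∂μ.prod (stdNoise ι) =
        Real.log σ + (∫ ω, (X ω k - Y ω k) ^ 2 ∂μ + 1) / (2 * σ ^ 2) - 1 / 2 := by
  have hresidual := (memLp_prod_add_mul_stdNoise hXY 1 k).integrable_sq.div_const (2 * σ ^ 2)
  have hnoise := ((memLp_eval_stdNoise k).integrable_sq.div_const 2).comp_snd μ
  have hllr : ∀ p : Ω × (ι → ℝ), gaussianLLR σ (X p.1 k) (Y p.1 k) (X p.1 k + p.2 k) =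
      Real.log σ + (X p.1 k - Y p.1 k + 1 * p.2 k) ^ 2 / (2 * σ ^ 2) - p.2 k ^ 2 / 2 := fun p => by
    rw [gaussianLLR]
    ring
  simp_rw [hllr]
  refine ⟨((integrable_const _).add hresidual).sub hnoise, ?_⟩
  rw [integral_sub (by exact (integrable_const _).add hresidual) hnoise,
    integral_add (integrable_const _) hresidual, integral_div,
    integral_prod_add_mul_stdNoise_sq hXY, integral_fun_snd (f := fun z : ι → ℝ => z k ^ 2 / 2),
    integral_div, integral_eval_sq_stdNoise]
  simp

theorem klDiv_gaussianChannelLaw {σ : ℝ} (hσ : 0 < σ) (hX : Measurable X) (hY : Measurable Y)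
    (hXY : ∀ k, MemLp (fun ω => X ω k - Y ω k) 2 μ) :
    klDiv (gaussianChannelLaw μ X 1) (gaussianChannelLaw μ Y σ) = ENNReal.ofReal
      (∑ k, (Real.log σ + (∫ ω, (X ω k - Y ω k) ^ 2 ∂μ + 1) / (2 * σ ^ 2) - 1 / 2)) := by
  set ℓ : Ω × (ι → ℝ) → ℝ := fun p => ∑ k, gaussianLLR σ (X p.1 k) (Y p.1 k) (p.2 k) with hℓ
  have hℓm : AEStronglyMeasurable ℓ (gaussianChannelLaw μ X 1) := by
    refine Measurable.aestronglyMeasurable ?_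
    simp only [hℓ, gaussianLLR]
    fun_prop
  have hchannel := (measurable_channel hX 1).aemeasurable (μ := μ.prod (stdNoise ι))
  have hint : Integrable ℓ (gaussianChannelLaw μ X 1) := by
    rw [gaussianChannelLaw, integrable_map_measure hℓm hchannel]
    refine integrable_finsetSum _ fun k _ => ?_
    simpa using (integral_gaussianLLR_channel (hXY k)).1
  have hdens : (gaussianChannelLaw μ X 1).withDensity (fun p => ENNReal.ofReal (Real.exp (-ℓ p))) =
      gaussianChannelLaw μ Y σ :=
    gaussianChannelLaw_withDensity_exp_neg_sum_gaussianLLR hσ hX hY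
  have := isProbabilityMeasure_gaussianChannelLaw (μ := μ) hX 1
  have : IsProbabilityMeasure
      ((gaussianChannelLaw μ X 1).withDensity fun p => ENNReal.ofReal (Real.exp (-ℓ p))) :=
    hdens ▸ isProbabilityMeasure_gaussianChannelLaw hY σ
  rw [← hdens, klDiv_withDensity_exp_neg hint, gaussianChannelLaw, integral_map hchannel hℓm]
  simp_rw [hℓ]
  rw [integral_finsetSum]
  · simp [(integral_gaussianLLR_channel (hXY _)).2]
  · intro k _
    simpa using (integral_gaussianLLR_channel (hXY k)).1

end GaussianChannel

section Genie

variable {ι Ω α β : Type*} [Fintype ι] [MeasurableSpace Ω] [MeasurableSpace α] [MeasurableSpace β]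

lemma exists_kernel_gaussianChannelLaw {m : Ω → ι → ℝ} (hm : Measurable m) (σ : ℝ) :
    ∃ κ : Kernel Ω (ι → ℝ), IsMarkovKernel κ ∧
      ∀ (μ : Measure Ω) [SFinite μ], gaussianChannelLaw μ m σ = μ ⊗ₘ κ := by
  have hout : Measurable fun p : Ω × (ι → ℝ) => m p.1 + σ • p.2 := (measurable_channel hm σ).snd
  refine ⟨(Kernel.id ×ₖ Kernel.const Ω (stdNoise ι)).map fun p => m p.1 + σ • p.2,
    Kernel.IsMarkovKernel.map _ hout, fun μ _ => Measure.ext_of_lintegral _ fun F hF => ?_⟩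
  have := Kernel.IsMarkovKernel.map (Kernel.id ×ₖ Kernel.const Ω (stdNoise ι)) hout
  rw [lintegral_gaussianChannelLaw hm σ hF, Measure.lintegral_compProd hF]
  refine lintegral_congr fun ω => ?_
  rw [Kernel.map_apply _ hout, Kernel.prod_apply, Kernel.id_apply, Kernel.const_apply,
    Measure.dirac_prod, Measure.map_map hout measurable_prodMk_left, ← stdNoise_map_add_smul]
  rfl

lemma fst_gaussianChannelLaw {μ : Measure Ω} [SFinite μ] {m : Ω → ι → ℝ} (hm : Measurable m)
    (σ : ℝ) : (gaussianChannelLaw μ m σ).fst = μ := by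
  obtain ⟨κ, _, hκ⟩ := exists_kernel_gaussianChannelLaw hm σ
  rw [hκ, Measure.fst_compProd]

lemma klDiv_gaussianChannelLaw_eq_add {ρ : Measure (Ω × (ι → ℝ))} [IsProbabilityMeasure ρ]
    {ν : Measure Ω} [IsProbabilityMeasure ν] {m : Ω → ι → ℝ} (hm : Measurable m) (σ : ℝ) :
    klDiv ρ (gaussianChannelLaw ν m σ) =
      klDiv ρ.fst ν + klDiv ρ (gaussianChannelLaw ρ.fst m σ) := by
  obtain ⟨κ, _, hκ⟩ := exists_kernel_gaussianChannelLaw hm σ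
  have hchain := klDiv_compProd_eq_add ρ.fst ν ρ.condKernel κ
  rwa [ρ.disintegrate ρ.condKernel, ← hκ, ← hκ] at hchain

lemma gaussianChannelLaw_map {μ : Measure Ω} [IsProbabilityMeasure μ] {U : Ω → α}
    (hU : Measurable U) {m : α → ι → ℝ} (hm : Measurable m) (σ : ℝ) :
    (gaussianChannelLaw μ (fun ω => m (U ω)) σ).map (Prod.map U id) =
      gaussianChannelLaw (μ.map U) m σ := by
  have hprod : (μ.map U).prod (stdNoise ι) = (μ.prod (stdNoise ι)).map (Prod.map U id) := by
    rw [← Measure.map_prod_map _ _ hU measurable_id, Measure.map_id]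
  have hmU : Measurable fun ω => m (U ω) := hm.comp hU
  rw [gaussianChannelLaw, gaussianChannelLaw, hprod,
    Measure.map_map (hU.prodMap measurable_id) (measurable_channel hmU σ),
    Measure.map_map (measurable_channel hm σ) (hU.prodMap measurable_id)]
  rfl

lemma gaussianChannelLaw_prod_map {μ : Measure α} {ν : Measure β} [IsProbabilityMeasure μ]
    [IsProbabilityMeasure ν] {m : β → ι → ℝ} (hm : Measurable m) (σ : ℝ) :
    (gaussianChannelLaw (μ.prod ν) (fun p => m p.2) σ).map (fun p => (p.1.1, p.2)) =
      μ.prod (gaussianChannelLaw ν m σ).snd := by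
  have hchannel := measurable_channel hm σ
  have hm' : Measurable fun p : α × β => m p.2 := hm.comp measurable_snd
  rw [gaussianChannelLaw, gaussianChannelLaw, Measure.snd, Measure.map_map (by fun_prop) hchannel,
    Measure.map_map (by fun_prop) (measurable_channel hm' σ)]
  nth_rw 2 [← μ.map_id]
  rw [Measure.map_prod_map _ _ measurable_id (by fun_prop), ← Measure.prodAssoc_prod,
    Measure.map_map (by fun_prop) (by fun_prop)]
  rfl

/-- The genie-aided bound: the output of the channel with input `m ∘ Y` is an artificial
observation that depends on `W` through `Y` only. -/
lemma klDiv_map_le_mutualInfo_add {ρ : Measure (Ω × (ι → ℝ))} [IsProbabilityMeasure ρ]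
    {W : Ω → α} {Y : Ω → β} (hW : Measurable W) (hY : Measurable Y) {m : β → ι → ℝ}
    (hm : Measurable m) (σ : ℝ) :
    klDiv (ρ.map fun p => (W p.1, p.2))
        ((ρ.fst.map W).prod (gaussianChannelLaw (ρ.fst.map Y) m σ).snd) ≤
      mutualInfo ρ.fst W Y + klDiv ρ (gaussianChannelLaw ρ.fst (fun ω => m (Y ω)) σ) := by
  have hWY : Measurable fun ω => (W ω, Y ω) := hW.prodMk hY
  have hm' : Measurable fun p : α × β => m p.2 := hm.comp measurable_snd
  have hpair : Measurable (Prod.map (fun ω => (W ω, Y ω)) (id : (ι → ℝ) → ι → ℝ)) :=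
    hWY.prodMap measurable_id
  have hdrop : Measurable fun p : (α × β) × (ι → ℝ) => (p.1.1, p.2) := by fun_prop
  have := Measure.isProbabilityMeasure_map (μ := ρ.fst) hW.aemeasurable
  have := Measure.isProbabilityMeasure_map (μ := ρ.fst) hY.aemeasurable
  have := Measure.isProbabilityMeasure_map (μ := ρ) hpair.aemeasurable
  have hmY : Measurable fun ω => m (Y ω) := hm.comp hY
  have := isProbabilityMeasure_gaussianChannelLaw (μ := ρ.fst) hmY σ
  have := isProbabilityMeasure_gaussianChannelLaw (μ := (ρ.fst.map W).prod (ρ.fst.map Y)) hm' σ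
  set τ := ρ.map (Prod.map (fun ω => (W ω, Y ω)) id) with hτ
  have hτ_fst : τ.fst = ρ.fst.map fun ω => (W ω, Y ω) := by
    rw [Measure.fst, Measure.fst, Measure.map_map measurable_fst hpair,
      Measure.map_map hWY measurable_fst]
    rfl
  calc klDiv (ρ.map fun p => (W p.1, p.2))
        ((ρ.fst.map W).prod (gaussianChannelLaw (ρ.fst.map Y) m σ).snd)
      = klDiv (τ.map fun p => (p.1.1, p.2))
          ((gaussianChannelLaw ((ρ.fst.map W).prod (ρ.fst.map Y)) (fun p => m p.2) σ).map
            fun p => (p.1.1, p.2)) := by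
        rw [gaussianChannelLaw_prod_map hm, hτ, Measure.map_map hdrop hpair]
        rfl
    _ ≤ klDiv τ (gaussianChannelLaw ((ρ.fst.map W).prod (ρ.fst.map Y)) (fun p => m p.2) σ) :=
        klDiv_map_le _ _ hdrop
    _ = mutualInfo ρ.fst W Y + klDiv τ (gaussianChannelLaw τ.fst (fun p => m p.2) σ) := by
        rw [klDiv_gaussianChannelLaw_eq_add hm', hτ_fst, mutualInfo]
    _ ≤ mutualInfo ρ.fst W Y + klDiv ρ (gaussianChannelLaw ρ.fst (fun ω => m (Y ω)) σ) := by
        rw [hτ_fst, ← gaussianChannelLaw_map hWY hm' σ]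
        gcongr
        exact klDiv_map_le _ _ hpair

/-- The summand `card ι * log σ` is the Gaussian cost of replacing `X + noise` by
`a • Y + σ • noise`. -/
theorem log_card_mul_integral_le_mutualInfo_add {𝒱 : Type*} [Fintype α]
    [MeasurableSingletonClass α] [Nonempty α] [Fintype 𝒱] {μ : Measure Ω} [IsProbabilityMeasure μ]
    {W : Ω → α} {V : Ω → 𝒱} {X Y : Ω → ι → ℝ} (hW : Measurable W) (hX : Measurable X)
    (hY : Measurable Y) (hunif : μ.map W = uniformOn Set.univ) (hinfo : mutualInfo μ W Y ≠ ⊤)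
    {q : (ι → ℝ) → α → 𝒱 → ℝ} (hq : ∀ w v, Measurable fun s => q s w v)
    (hq0 : ∀ s w v, 0 ≤ q s w v) (hsum : ∀ s v, ∑ w, q s w v ≤ 1) {a σ : ℝ} (hσ : 1 ≤ σ)
    (hXY : ∀ k, MemLp (fun ω => X ω k - (a • Y ω) k) 2 μ)
    (hmse : ∑ k, (∫ ω, (X ω k - (a • Y ω) k) ^ 2 ∂μ + 1) ≤ Fintype.card ι * σ ^ 2) :
    Real.log (Fintype.card α) * ∫ p, q p.2 (W p.1) (V p.1) ∂gaussianChannelLaw μ X 1 ≤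
      (mutualInfo μ W Y).toReal + Fintype.card ι * Real.log σ + Real.log (Fintype.card 𝒱) + 1 := by
  have haY : Measurable fun y : ι → ℝ => a • y := measurable_id.const_smul a
  have haYω : Measurable fun ω => a • Y ω := haY.comp hY
  have hσ0 : 0 < σ := by positivity
  have := isProbabilityMeasure_gaussianChannelLaw (μ := μ) hX 1
  have := Measure.isProbabilityMeasure_map (μ := μ) hY.aemeasurable
  have := isProbabilityMeasure_gaussianChannelLaw (μ := μ.map Y) haY σ
  set cost := ∑ k, (Real.log σ + (∫ ω, (X ω k - (a • Y ω) k) ^ 2 ∂μ + 1) / (2 * σ ^ 2) - 1 / 2)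
    with hcost
  have hcost_le : cost ≤ Fintype.card ι * Real.log σ := by
    have hquot : (∑ k, (∫ ω, (X ω k - (a • Y ω) k) ^ 2 ∂μ + 1)) / (2 * σ ^ 2) ≤
        Fintype.card ι * (1 / 2) := by
      rw [div_le_iff₀ (by positivity)]
      linarith
    rw [hcost, Finset.sum_sub_distrib, Finset.sum_add_distrib, ← Finset.sum_div]
    simp only [Finset.sum_const, Finset.card_univ, nsmul_eq_mul]
    linarith
  have hgenie := klDiv_map_le_mutualInfo_add (ρ := gaussianChannelLaw μ X 1) hW hY haY σ
  rw [fst_gaussianChannelLaw hX, klDiv_gaussianChannelLaw hσ0 hX haYω hXY, ← hcost,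
    hunif] at hgenie
  replace hgenie := hgenie.trans (by gcongr :
    _ ≤ mutualInfo μ W Y + ENNReal.ofReal (Fintype.card ι * Real.log σ))
  have hfin := ENNReal.add_ne_top.2
    ⟨hinfo, ENNReal.ofReal_ne_top (r := Fintype.card ι * Real.log σ)⟩
  have hfano := log_card_mul_integral_le_toReal_klDiv (W := fun p : Ω × (ι → ℝ) => W p.1)
    (V := fun p => V p.1) (hW.comp measurable_fst) measurable_snd hq hq0 hsum
    (ne_top_of_le_ne_top hfin hgenie)
  have hkl := ENNReal.toReal_mono hfin hgenie
  rw [ENNReal.toReal_add hinfo ENNReal.ofReal_ne_top,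
    ENNReal.toReal_ofReal (mul_nonneg (Nat.cast_nonneg _) (Real.log_nonneg hσ))] at hkl
  linarith

end Genie

section ProductMeasures

variable {ι : Type*} [Fintype ι] {α β : ι → Type*} [∀ i, MeasurableSpace (α i)]
  [∀ i, MeasurableSpace (β i)] (μ : ∀ i, Measure (α i))

lemma measurePreserving_prod_pi (ν : ∀ i, Measure (β i)) [∀ i, SigmaFinite (μ i)]
    [∀ i, SigmaFinite (ν i)] :
    MeasurePreserving (fun (p : (∀ i, α i) × (∀ i, β i)) i => (p.1 i, p.2 i))
      ((Measure.pi μ).prod (Measure.pi ν)) (Measure.pi fun i => (μ i).prod (ν i)) := by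
  have hm : Measurable fun (p : (∀ i, α i) × (∀ i, β i)) i => (p.1 i, p.2 i) := by fun_prop
  refine ⟨hm, (Measure.pi_eq_generateFrom (fun i => generateFrom_prod) (fun i => isPiSystem_prod)
    (fun i => (μ i).toFiniteSpanningSetsIn.prod (ν i).toFiniteSpanningSetsIn) ?_).symm⟩
  intro u hu
  choose s hs t ht hst using hu
  obtain rfl : (fun i => s i ×ˢ t i) = u := funext hst
  have hpre : (fun (p : (∀ i, α i) × (∀ i, β i)) i => (p.1 i, p.2 i)) ⁻¹'
      Set.univ.pi (fun i => s i ×ˢ t i) = Set.univ.pi s ×ˢ Set.univ.pi t := by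
    ext p
    simp [forall_and]
  rw [Measure.map_apply hm (.univ_pi fun i => (hs i).prod (ht i)), hpre]
  simp [Measure.prod_prod, Measure.pi_pi, Finset.prod_mul_distrib]

lemma measurePreserving_update [DecidableEq ι] [∀ i, IsProbabilityMeasure (μ i)] (j : ι) :
    MeasurePreserving (fun p : (∀ i, α i) × α j => Function.update p.1 j p.2)
      ((Measure.pi μ).prod (μ j)) (Measure.pi μ) := by
  have hm : Measurable fun p : (∀ i, α i) × α j => Function.update p.1 j p.2 :=
    measurable_update'
  refine ⟨hm, (Measure.pi_eq fun s hs => ?_).symm⟩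
  have hpre : (fun p : (∀ i, α i) × α j => Function.update p.1 j p.2) ⁻¹' Set.univ.pi s =
      Set.univ.pi (Function.update s j Set.univ) ×ˢ s j := by
    ext p
    rw [Set.mem_preimage, Set.mem_prod, Set.mem_univ_pi, Set.mem_univ_pi,
      Function.forall_update_iff p.1 fun i x => x ∈ s i,
      Function.forall_update_iff s fun i t => p.1 i ∈ t]
    simp [and_comm]
  have hprod : ∏ i ∈ Finset.univ.erase j, μ i (Function.update s j Set.univ i) =
      ∏ i ∈ Finset.univ.erase j, μ i (s i) := Finset.prod_congr rfl fun i hi => by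
    rw [Function.update_of_ne (Finset.ne_of_mem_erase hi)]
  rw [Measure.map_apply hm (.univ_pi hs), hpre, Measure.prod_prod, Measure.pi_pi,
    ← Finset.mul_prod_erase _ _ (Finset.mem_univ j), hprod, Function.update_self, measure_univ,
    one_mul, mul_comm, Finset.mul_prod_erase _ (fun i => μ i (s i)) (Finset.mem_univ j)]

end ProductMeasures

section RectangularFibres

lemma smul_cond {Ω : Type*} [MeasurableSpace Ω] (μ : Measure Ω) [IsFiniteMeasure μ] (s : Set Ω) :
    μ s • μ[|s] = μ.restrict s := by
  rcases eq_or_ne (μ s) 0 with hs | hs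
  · rw [Measure.restrict_eq_zero.2 hs, hs, zero_smul]
  · rw [ProbabilityTheory.cond, smul_smul, ENNReal.mul_inv_cancel hs (measure_ne_top μ s), one_smul]

lemma lintegral_eq_sum_setLIntegral_preimage_singleton {Ω 𝒱 : Type*} [MeasurableSpace Ω]
    [Fintype 𝒱] {P : Measure Ω} {V : Ω → 𝒱} (hV : ∀ v, MeasurableSet (V ⁻¹' {v}))
    (F : Ω → ENNReal) :
    ∫⁻ ω, F ω ∂P = ∑ v, ∫⁻ ω in V ⁻¹' {v}, F ω ∂P := by
  rw [← setLIntegral_univ, ← Set.preimage_univ (f := V), ← Set.iUnion_of_singleton 𝒱,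
    Set.preimage_iUnion, lintegral_iUnion hV, tsum_fintype]
  exact fun v w hvw => Disjoint.preimage _ (by simpa using hvw)

lemma measurable_comp_of_finite {Ω α β 𝒱 : Type*} [MeasurableSpace Ω] [MeasurableSpace α]
    [MeasurableSpace β] [Finite 𝒱] {V : Ω → 𝒱} (hV : ∀ v, MeasurableSet (V ⁻¹' {v})) {X : Ω → α}
    (hX : Measurable X) {f : 𝒱 → α → β} (hf : ∀ v, Measurable (f v)) :
    Measurable fun ω => f (V ω) (X ω) := by
  let _ : MeasurableSpace 𝒱 := ⊤
  have hV' : Measurable V := measurable_to_countable' hV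
  have hf' : Measurable fun p : 𝒱 × α => f p.1 p.2 := measurable_from_prod_countable_right hf
  exact hf'.comp (hV'.prodMk hX)

variable {Ω α β 𝒱 : Type*} [MeasurableSpace Ω] [MeasurableSpace α] [MeasurableSpace β]
  {P : Measure Ω} [IsProbabilityMeasure P] {X : Ω → α} {Y : Ω → β}

lemma setLIntegral_indepFun_comp (hX : Measurable X) (hY : Measurable Y) (hXY : IndepFun X Y P)
    {A : Set α} {B : Set β} (hA : MeasurableSet A) (hB : MeasurableSet B) {F : α → β → ENNReal}
    (hF : Measurable (Function.uncurry F)) :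
    ∫⁻ ω in (fun ω => (X ω, Y ω)) ⁻¹' (A ×ˢ B), F (X ω) (Y ω) ∂P =
      ∫⁻ x in A, ∫⁻ y in B, F x y ∂P.map Y ∂P.map X := by
  change ∫⁻ ω in (fun ω => (X ω, Y ω)) ⁻¹' (A ×ˢ B), Function.uncurry F (X ω, Y ω) ∂P = _
  rw [← setLIntegral_map (hA.prod hB) hF (hX.prodMk hY),
    (indepFun_iff_map_prod_eq_prod_map_map hX.aemeasurable hY.aemeasurable).1 hXY,
    setLIntegral_prod _ hF.aemeasurable]
  rfl

/-- Given the value of a variable `V` with rectangular fibres, the independent variables `X` and `Y`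
remain independent. -/
theorem lintegral_eq_lintegral_lintegral_cond [Finite 𝒱] (hX : Measurable X) (hY : Measurable Y)
    (hXY : IndepFun X Y P) {V : Ω → 𝒱} {A : 𝒱 → Set α} {B : 𝒱 → Set β}
    (hA : ∀ v, MeasurableSet (A v)) (hB : ∀ v, MeasurableSet (B v))
    (hV : ∀ v, V ⁻¹' {v} = (fun ω => (X ω, Y ω)) ⁻¹' (A v ×ˢ B v)) {F : 𝒱 → α → β → ENNReal}
    (hF : ∀ v, Measurable (Function.uncurry (F v))) :
    ∫⁻ ω, F (V ω) (X ω) (Y ω) ∂P = ∫⁻ ω, ∫⁻ y, F (V ω) (X ω) y ∂(P.map Y)[|B (V ω)] ∂P := by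
  have := Fintype.ofFinite 𝒱
  have := Measure.isProbabilityMeasure_map (μ := P) hY.aemeasurable
  have hfib : ∀ v, MeasurableSet (V ⁻¹' {v}) := fun v =>
    hV v ▸ hX.prodMk hY ((hA v).prod (hB v))
  rw [lintegral_eq_sum_setLIntegral_preimage_singleton hfib,
    lintegral_eq_sum_setLIntegral_preimage_singleton hfib]
  refine Finset.sum_congr rfl fun v _ => ?_
  have hcond : Measurable fun x => ∫⁻ y, F v x y ∂(P.map Y)[|B v] := (hF v).lintegral_prod_right'
  calc ∫⁻ ω in V ⁻¹' {v}, F (V ω) (X ω) (Y ω) ∂P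
      = ∫⁻ ω in V ⁻¹' {v}, F v (X ω) (Y ω) ∂P :=
        setLIntegral_congr_fun (hfib v) fun ω hω => by rw [Set.mem_preimage.1 hω]
    _ = ∫⁻ x in A v, ∫⁻ y in B v, F v x y ∂P.map Y ∂P.map X := by
        rw [hV, setLIntegral_indepFun_comp hX hY hXY (hA v) (hB v) (hF v)]
    _ = ∫⁻ x in A v, ∫⁻ _ in B v, ∫⁻ y', F v x y' ∂(P.map Y)[|B v] ∂P.map Y ∂P.map X := by
        congr with x
        rw [setLIntegral_const, mul_comm, ← smul_eq_mul, ← lintegral_smul_measure, smul_cond]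
    _ = ∫⁻ ω in V ⁻¹' {v}, ∫⁻ y', F v (X ω) y' ∂(P.map Y)[|B v] ∂P := by
        rw [hV, ← setLIntegral_indepFun_comp hX hY hXY (hA v) (hB v)
          (F := fun x _ => ∫⁻ y, F v x y ∂(P.map Y)[|B v]) (hcond.comp measurable_fst)]
    _ = ∫⁻ ω in V ⁻¹' {v}, ∫⁻ y', F (V ω) (X ω) y' ∂(P.map Y)[|B (V ω)] ∂P :=
        setLIntegral_congr_fun (hfib v) fun ω hω => by rw [Set.mem_preimage.1 hω]

theorem measureReal_eq_integral_cond [Finite 𝒱] (hX : Measurable X) (hY : Measurable Y)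
    (hXY : IndepFun X Y P) {V : Ω → 𝒱} {A : 𝒱 → Set α} {B : 𝒱 → Set β}
    (hA : ∀ v, MeasurableSet (A v)) (hB : ∀ v, MeasurableSet (B v))
    (hV : ∀ v, V ⁻¹' {v} = (fun ω => (X ω, Y ω)) ⁻¹' (A v ×ˢ B v)) {E : 𝒱 → Set (α × β)}
    (hE : ∀ v, MeasurableSet (E v)) :
    P.real {ω | (X ω, Y ω) ∈ E (V ω)} =
      ∫ ω, ((P.map Y)[|B (V ω)]).real (Prod.mk (X ω) ⁻¹' E (V ω)) ∂P := by
  have hfib : ∀ v, MeasurableSet (V ⁻¹' {v}) := fun v =>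
    hV v ▸ hX.prodMk hY ((hA v).prod (hB v))
  have hind := lintegral_eq_lintegral_lintegral_cond hX hY hXY hA hB hV
    (F := fun v x y => (E v).indicator 1 (x, y)) fun v => measurable_one.indicator (hE v)
  have hevent : MeasurableSet {ω | (X ω, Y ω) ∈ E (V ω)} :=
    measurable_comp_of_finite hfib (hX.prodMk hY) (f := fun v p => p ∈ E v)
      (fun v => measurableSet_setOfPred.1 (hE v)) |>.setOf
  have hslice : Measurable fun ω => (P.map Y)[|B (V ω)] (Prod.mk (X ω) ⁻¹' E (V ω)) :=
    measurable_comp_of_finite hfib hX (f := fun v x => (P.map Y)[|B v] (Prod.mk x ⁻¹' E v))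
      fun v => measurable_measure_prodMk_left (hE v)
  simp only [measureReal_def]
  rw [integral_toReal hslice.aemeasurable (ae_of_all _ fun ω => measure_lt_top _ _),
    ← lintegral_indicator_one hevent]
  refine congrArg ENNReal.toReal (hind.trans (lintegral_congr fun ω => ?_))
  exact lintegral_indicator_one (measurable_prodMk_left (hE (V ω)))

end RectangularFibres

namespace ICCode

variable {N : ℕ} (c : ICCode N)

section Transmitters

/-- The message and the local randomness of transmitter `i`. -/
abbrev User (i : Fin 2) : Type := Fin (c.numMsg i) × c.Rand i

/-- The data of transmitter `i` at the sample point `ω`. -/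
def user (i : Fin 2) (ω : c.Sample) : c.User i := (ω.1 i, ω.2.1 i)

/-- All the cooperative symbols of a block. -/
abbrev CoopHist : Type := ∀ (i : Fin 2) (k : Fin N), Fin (c.coopCard i k)

/-- The data of transmitter `i` which are compatible with the cooperative symbols `v`. -/
def compatible (i : Fin 2) (v : c.CoopHist) : Set (c.User i) :=
  {t | ∀ k, c.coop i k t.1 t.2 (fun l => v i.rev l.1) = v i k}

/-- The input block of transmitter `i` when the cooperative symbols are `v`. -/
def userInput (i : Fin 2) (v : c.CoopHist) (t : c.User i) : Fin N → ℝ :=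
  fun k => c.enc i k t.1 t.2 (fun l => v i.rev l.1)

lemma input_eq_userInput (i : Fin 2) (k : Fin N) (ω : c.Sample) :
    c.input i k ω = c.userInput i (c.coopSymbol ω) (c.user i ω) k :=
  rfl

lemma coopSymbol_eq_iff (ω : c.Sample) (v : c.CoopHist) :
    c.coopSymbol ω = v ↔ ∀ i, c.user i ω ∈ c.compatible i v := by
  refine ⟨?_, fun h => ?_⟩
  · rintro rfl i k
    rw [coopSymbol]
    rfl
  · have hsymbol : ∀ (k : Fin N) (i : Fin 2), c.coopSymbol ω i k = v i k := by
      intro k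
      induction k using WellFoundedLT.induction with
      | ind k ih =>
        intro i
        rw [coopSymbol, ← h i k]
        congr 1
        ext1 l
        exact ih l.1 l.2 i.rev
    exact funext₂ fun i k => hsymbol k i

lemma preimage_coopSymbol_singleton (i : Fin 2) (v : c.CoopHist) :
    c.coopSymbol ⁻¹' {v} =
      c.user i ⁻¹' c.compatible i v ∩ c.user i.rev ⁻¹' c.compatible i.rev v := by
  ext ω
  rw [Set.mem_preimage, Set.mem_singleton_iff, coopSymbol_eq_iff, Fin.forall_fin_two]
  fin_cases i
  · rfl
  · exact and_comm

lemma measurable_user (i : Fin 2) : Measurable (c.user i) := by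
  unfold user
  fun_prop

lemma measurableSet_compatible (i : Fin 2) (v : c.CoopHist) :
    MeasurableSet (c.compatible i v) := by
  have hcoop : ∀ k, Measurable fun t : c.User i => c.coop i k t.1 t.2 (fun l => v i.rev l.1) :=
    fun k => measurable_from_prod_countable_right fun w => c.measurable_coop i k w _
  rw [compatible, Set.ofPred_forall]
  exact .iInter fun k => hcoop k (measurableSet_singleton _)

lemma measurable_userInput (i : Fin 2) (v : c.CoopHist) : Measurable (c.userInput i v) :=
  measurable_pi_lambda _ fun k =>
    measurable_from_prod_countable_right fun w => c.measurable_enc i k w _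

lemma measurableSet_preimage_coopSymbol_singleton (v : c.CoopHist) :
    MeasurableSet (c.coopSymbol ⁻¹' {v}) := by
  rw [c.preimage_coopSymbol_singleton 0]
  exact (c.measurable_user _ (c.measurableSet_compatible _ v)).inter
    (c.measurable_user _ (c.measurableSet_compatible _ v))

lemma measurable_msg (i : Fin 2) : Measurable (c.msg i) :=
  (measurable_pi_apply i).comp measurable_fst

lemma measurable_input (i : Fin 2) (k : Fin N) : Measurable (c.input i k) :=
  measurable_comp_of_finite c.measurableSet_preimage_coopSymbol_singleton (c.measurable_user i)
    (f := fun v t => c.userInput i v t k) fun v =>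
      (measurable_pi_apply k).comp (c.measurable_userInput i v)

lemma measurable_output (hd hc : ℝ) (i : Fin 2) : Measurable (c.output hd hc i) := by
  have hinput := c.measurable_input
  unfold output
  fun_prop

instance isProbabilityMeasure_uniformOn_msg (i : Fin 2) :
    IsProbabilityMeasure (uniformOn (Set.univ : Set (Fin (c.numMsg i)))) := by
  have : NeZero (c.numMsg i) := ⟨(c.numMsg_pos i).ne'⟩
  exact isProbabilityMeasure_uniformOn Set.finite_univ Set.univ_nonempty

instance isProbabilityMeasure_prob : IsProbabilityMeasure c.prob := by
  unfold prob
  infer_instance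

lemma map_msg (i : Fin 2) : c.prob.map (c.msg i) = uniformOn Set.univ :=
  ((measurePreserving_eval _ i).comp measurePreserving_fst).map_eq

lemma indepFun_user_noise_user_rev (i : Fin 2) :
    IndepFun (fun ω => (c.user i ω, ω.2.2 i)) (c.user i.rev) c.prob := by
  let node (ω : c.Sample) (j : Fin 2) : Fin (c.numMsg j) × c.Rand j × (Fin N → ℝ) :=
    (ω.1 j, ω.2.1 j, ω.2.2 j)
  have hmp : MeasurePreserving node c.prob (Measure.pi fun j =>
      (uniformOn Set.univ).prod ((c.randLaw j).prod (stdNoise (Fin N)))) :=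
    (measurePreserving_prod_pi _ _).comp
      ((MeasurePreserving.id _).prod (measurePreserving_prod_pi _ _))
  have hindep : iIndepFun (fun j ω => node ω j) c.prob := by
    rw [iIndepFun_iff_map_fun_eq_pi_map fun j => by fun_prop, hmp.map_eq]
    exact congrArg Measure.pi (funext fun j => ((measurePreserving_eval _ j).comp hmp).map_eq.symm)
  have hne : i ≠ i.rev := by fin_cases i <;> decide
  exact (hindep.indepFun hne).comp
    (φ := fun t : Fin (c.numMsg i) × c.Rand i × (Fin N → ℝ) => ((t.1, t.2.1), t.2.2))
    (ψ := fun t : Fin (c.numMsg i.rev) × c.Rand i.rev × (Fin N → ℝ) => (t.1, t.2.1))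
    (by fun_prop) (by fun_prop)

lemma log_card_coopHist_le {CG : ℝ} (h : c.CoopRateLE CG) :
    Real.log (Fintype.card c.CoopHist) ≤ 2 * (N * CG * Real.log 2) := by
  obtain ⟨ω⟩ : Nonempty c.Sample := nonempty_of_isProbabilityMeasure c.prob
  have hpos : ∀ i, (0 : ℝ) < ((∏ k, c.coopCard i k : ℕ) : ℝ) := fun i => by
    exact_mod_cast Finset.prod_pos fun k _ => (c.coopSymbol ω i k).pos
  have hlog : ∀ i, Real.log ((∏ k, c.coopCard i k : ℕ) : ℝ) ≤ N * CG * Real.log 2 := fun i => by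
    rw [← Real.log_rpow two_pos]
    exact Real.log_le_log (hpos i) (h i)
  have hcard : (Fintype.card c.CoopHist : ℝ) =
      ((∏ k, c.coopCard 0 k : ℕ) : ℝ) * ((∏ k, c.coopCard 1 k : ℕ) : ℝ) := by
    rw [Fintype.card_pi, Fin.prod_univ_two]
    simp [Fintype.card_pi]
  rw [hcard, Real.log_mul (hpos 0).ne' (hpos 1).ne']
  linarith [hlog 0, hlog 1]

end Transmitters

section Resampling

/-- Replaces the noise of receiver `j` by an independent copy. -/
def resample (j : Fin 2) (p : c.Sample × (Fin N → ℝ)) : c.Sample :=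
  (p.1.1, p.1.2.1, Function.update p.1.2.2 j p.2)

lemma measurePreserving_resample (j : Fin 2) :
    MeasurePreserving (c.resample j) (c.prob.prod (stdNoise (Fin N))) c.prob :=
  ((MeasurePreserving.id _).prod
    (((MeasurePreserving.id _).prod
      (measurePreserving_update (fun _ : Fin 2 => stdNoise (Fin N)) j)).comp
        (measurePreserving_prodAssoc _ _ _))).comp (measurePreserving_prodAssoc _ _ _)

lemma coopSymbol_resample (j : Fin 2) (p : c.Sample × (Fin N → ℝ)) :
    c.coopSymbol (c.resample j p) = c.coopSymbol p.1 :=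
  (c.coopSymbol_eq_iff _ _).2 ((c.coopSymbol_eq_iff p.1 _).1 rfl)

lemma input_resample (j i : Fin 2) (k : Fin N) (p : c.Sample × (Fin N → ℝ)) :
    c.input i k (c.resample j p) = c.input i k p.1 := by
  rw [input_eq_userInput, coopSymbol_resample]
  rfl

lemma noise_resample_self (j : Fin 2) (p : c.Sample × (Fin N → ℝ)) :
    (c.resample j p).2.2 j = p.2 :=
  Function.update_self (β := fun _ => Fin N → ℝ) j p.2 p.1.2.2

lemma output_resample_self (hd hc : ℝ) (i : Fin 2) (k : Fin N) (p : c.Sample × (Fin N → ℝ)) :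
    c.output hd hc i (c.resample i p) k =
      hd * c.input i k p.1 + hc * c.input i.rev k p.1 + p.2 k := by
  rw [output, input_resample, input_resample, noise_resample_self]

lemma integral_comp_resample (j : Fin 2) {F : c.Sample → ℝ} (hF : Measurable F) :
    ∫ p, F (c.resample j p) ∂c.prob.prod (stdNoise (Fin N)) = ∫ ω, F ω ∂c.prob := by
  have hmp := c.measurePreserving_resample j
  exact (integral_map hmp.measurable.aemeasurable hF.aestronglyMeasurable).symm.trans
    (by rw [hmp.map_eq])

end Resampling

section SoftDecoder

variable (hd hc : ℝ) (i : Fin 2)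

/-- The conditional probability, given the cooperative symbols `v`, that receiver `i` decodes `w`
when it observes `s` plus the interference of the other transmitter. -/
noncomputable def softDecoder (s : Fin N → ℝ) (w : Fin (c.numMsg i)) (v : c.CoopHist) : ℝ :=
  ((c.prob.map (c.user i.rev))[|c.compatible i.rev v]).real
    {t | c.dec i (s + hc • c.userInput i.rev v t) = w}

lemma measurable_dec_add_interference (v : c.CoopHist) :
    Measurable fun p : (Fin N → ℝ) × c.User i.rev =>
      c.dec i (p.1 + hc • c.userInput i.rev v p.2) := by
  have huser := c.measurable_userInput i.rev v
  exact (c.measurable_dec i).comp (by fun_prop)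

lemma measurable_softDecoder (w : Fin (c.numMsg i)) (v : c.CoopHist) :
    Measurable fun s => c.softDecoder hc i s w v :=
  (measurable_measure_prodMk_left
    (c.measurable_dec_add_interference hc i v (measurableSet_singleton w))).ennreal_toReal

lemma sum_softDecoder_le_one (s : Fin N → ℝ) (v : c.CoopHist) :
    ∑ w, c.softDecoder hc i s w v ≤ 1 := by
  have hdec : Measurable fun t => c.dec i (s + hc • c.userInput i.rev v t) :=
    (c.measurable_dec_add_interference hc i v).comp measurable_prodMk_left
  exact (sum_measureReal_preimage_singleton
    (μ := (c.prob.map (c.user i.rev))[|c.compatible i.rev v]) Finset.univ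
    (fun w _ => hdec (measurableSet_singleton w))
    fun _ _ => measure_ne_top _ _).trans_le measureReal_le_one

/-- Given the cooperative symbols, the interference is independent of the message, the input and
the noise of user `i`, so the decoder can be replaced by its conditional success probability. -/
lemma one_sub_errorProb_eq_integral :
    1 - c.errorProb hd hc i = ∫ ω, c.softDecoder hc i
      (fun k => hd * c.input i k ω + ω.2.2 i k) (c.msg i ω) (c.coopSymbol ω) ∂c.prob := by
  have herr : MeasurableSet {ω | c.dec i (c.output hd hc i ω) ≠ c.msg i ω} :=
    (measurableSet_eq_fun ((c.measurable_dec i).comp (c.measurable_output hd hc i))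
      (c.measurable_msg i)).compl
  let success (v : c.CoopHist) : Set ((c.User i × (Fin N → ℝ)) × c.User i.rev) :=
    {p | c.dec i (hd • c.userInput i v p.1.1 + p.1.2 + hc • c.userInput i.rev v p.2) = p.1.1.1}
  have hsuccess : ∀ v, MeasurableSet (success v) := fun v => by
    have huser := c.measurable_userInput i v
    have hsignal : Measurable fun p : (c.User i × (Fin N → ℝ)) × c.User i.rev =>
        (hd • c.userInput i v p.1.1 + p.1.2, p.2) := by fun_prop
    exact measurableSet_eq_fun ((c.measurable_dec_add_interference hc i v).comp hsignal)
      (by fun_prop)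
  have hnoise : Measurable fun ω : c.Sample => ω.2.2 i := by fun_prop
  rw [errorProb, ← probReal_compl_eq_one_sub herr]
  refine Eq.trans ?_ (measureReal_eq_integral_cond ((c.measurable_user i).prodMk hnoise)
    (c.measurable_user i.rev) (c.indepFun_user_noise_user_rev i)
    (fun v => measurable_fst (c.measurableSet_compatible i v))
    (c.measurableSet_compatible i.rev) (c.preimage_coopSymbol_singleton i) hsuccess)
  congr 1 with ω
  have houtput : c.output hd hc i ω = hd • c.userInput i (c.coopSymbol ω) (c.user i ω) +
      ω.2.2 i + hc • c.userInput i.rev (c.coopSymbol ω) (c.user i.rev ω) :=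
    funext fun k => add_right_comm _ _ _
  rw [Set.mem_compl_iff, Set.mem_ofPred_eq, not_not, houtput]
  rfl

lemma one_sub_errorProb_eq_integral_gaussianChannelLaw :
    1 - c.errorProb hd hc i = ∫ p, c.softDecoder hc i p.2 (c.msg i p.1) (c.coopSymbol p.1)
      ∂gaussianChannelLaw c.prob (fun ω k => hd * c.input i k ω) 1 := by
  have hinput : Measurable fun ω k => hd * c.input i k ω :=
    measurable_pi_lambda _ fun k => (c.measurable_input i k).const_mul hd
  have hdecoder : Measurable fun p : c.Sample × (Fin N → ℝ) =>
      c.softDecoder hc i p.2 (c.msg i p.1) (c.coopSymbol p.1) := by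
    have hfib : ∀ v, MeasurableSet
        ((fun p : c.Sample × (Fin N → ℝ) => c.coopSymbol p.1) ⁻¹' {v}) :=
      fun v => measurable_fst (c.measurableSet_preimage_coopSymbol_singleton v)
    have hmsg : Measurable fun p : c.Sample × (Fin N → ℝ) => c.msg i p.1 :=
      (c.measurable_msg i).comp measurable_fst
    exact measurable_comp_of_finite hfib (hmsg.prodMk measurable_snd)
      (f := fun v p => c.softDecoder hc i p.2 p.1 v) fun v =>
        measurable_from_prod_countable_right fun w => c.measurable_softDecoder hc i w v
  have hreceived : Measurable fun ω : c.Sample =>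
      (ω, fun k => hd * c.input i k ω + ω.2.2 i k) := by
    have := c.measurable_input
    fun_prop
  rw [one_sub_errorProb_eq_integral, gaussianChannelLaw,
    integral_map (measurable_channel hinput 1).aemeasurable hdecoder.aestronglyMeasurable]
  refine (c.integral_comp_resample i (hdecoder.comp hreceived)).symm.trans
    (integral_congr_ae (ae_of_all _ fun p => ?_))
  simp only [Function.comp_apply, input_resample, coopSymbol_resample, noise_resample_self,
    one_smul]
  rfl

end SoftDecoder

section Residual

variable (hd hc a : ℝ) (i : Fin 2) (k : Fin N)

lemma memLp_sub_mul_output (hL : ∀ i k, MemLp (c.input i k) 2 c.prob) :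
    MemLp (fun ω => hd * c.input i k ω - a * c.output hd hc i.rev ω k) 2 c.prob := by
  have hnoise : MemLp (fun ω : c.Sample => ω.2.2 i.rev k) 2 c.prob :=
    (memLp_eval_stdNoise k).comp_measurePreserving ((measurePreserving_eval _ i.rev).comp
      (measurePreserving_snd.comp measurePreserving_snd))
  exact ((hL i k).const_mul hd).sub
    (((((hL _ k).const_mul hd).add ((hL _ k).const_mul hc)).add hnoise).const_mul a)

lemma integral_sub_mul_output_sq (hL : ∀ i k, MemLp (c.input i k) 2 c.prob) :
    ∫ ω, (hd * c.input i k ω - a * c.output hd hc i.rev ω k) ^ 2 ∂c.prob =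
      ∫ ω, ((hd - a * hc) * c.input i k ω - a * hd * c.input i.rev k ω) ^ 2 ∂c.prob + a ^ 2 := by
  have hresidual : MemLp (fun ω => (hd - a * hc) * c.input i k ω - a * hd * c.input i.rev k ω) 2
      c.prob := ((hL i k).const_mul _).sub ((hL i.rev k).const_mul _)
  have hmeas : Measurable fun ω => (hd * c.input i k ω - a * c.output hd hc i.rev ω k) ^ 2 := by
    have hinput := c.measurable_input i k
    have houtput := c.measurable_output hd hc i.rev
    fun_prop
  rw [← neg_sq a, ← integral_prod_add_mul_stdNoise_sq hresidual (-a) k,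
    ← c.integral_comp_resample i.rev hmeas]
  refine integral_congr_ae (ae_of_all _ fun p => ?_)
  simp only [input_resample, output_resample_self, Fin.rev_rev]
  ring

end Residual

theorem log_numMsg_mul_le {CG : ℝ} (hrate : c.CoopRateLE CG) (hd hc : ℝ)
    (hL : ∀ i k, MemLp (c.input i k) 2 c.prob) (i : Fin 2) (hfin : c.leakage hd hc i ≠ ⊤) {a σ : ℝ}
    (hσ : 1 ≤ σ)
    (hmse : ∑ k, ∫ ω, ((hd - a * hc) * c.input i k ω - a * hd * c.input i.rev k ω) ^ 2 ∂c.prob ≤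
      N * (σ ^ 2 - 1 - a ^ 2)) :
    Real.log (c.numMsg i) * (1 - c.errorProb hd hc i) ≤
      (c.leakage hd hc i).toReal + 1 + 2 * (N * CG * Real.log 2) + N * Real.log σ := by
  have : Nonempty (Fin (c.numMsg i)) := ⟨⟨0, c.numMsg_pos i⟩⟩
  have hinput : Measurable fun ω k => hd * c.input i k ω :=
    measurable_pi_lambda _ fun k => (c.measurable_input i k).const_mul hd
  have hgenie := log_card_mul_integral_le_mutualInfo_add (V := c.coopSymbol) (c.measurable_msg i)
    hinput (c.measurable_output hd hc i.rev) (c.map_msg i) hfin (c.measurable_softDecoder hc i)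
    (fun _ _ _ => measureReal_nonneg) (c.sum_softDecoder_le_one hc i) (a := a) hσ
    (fun k => c.memLp_sub_mul_output hd hc a i k hL) (by
      simp only [Pi.smul_apply, smul_eq_mul, c.integral_sub_mul_output_sq hd hc a i _ hL]
      simp only [Finset.sum_add_distrib, Finset.sum_const, Finset.card_univ, Fintype.card_fin,
        nsmul_eq_mul]
      linarith)
  rw [← one_sub_errorProb_eq_integral_gaussianChannelLaw, Fintype.card_fin,
    Fintype.card_fin] at hgenie
  refine hgenie.trans ?_
  have := c.log_card_coopHist_le hrate
  rw [leakage]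
  linarith

end ICCode

section Correlation

lemma memLp_two_of_lintegral_sq_ne_top {Ω : Type*} [MeasurableSpace Ω] {μ : Measure Ω} {x : Ω → ℝ}
    (hx : Measurable x) (h : ∫⁻ ω, ENNReal.ofReal (x ω ^ 2) ∂μ ≠ ⊤) : MemLp x 2 μ := by
  rw [memLp_two_iff_integrable_sq hx.aestronglyMeasurable]
  refine ⟨(hx.pow_const 2).aestronglyMeasurable, ?_⟩
  rw [hasFiniteIntegral_iff_ofReal (ae_of_all _ fun ω => sq_nonneg (x ω))]
  exact lt_top_iff_ne_top.2 h

variable {Ω ι : Type*} [MeasurableSpace Ω] [Fintype ι] {μ : Measure Ω} {x y : ι → Ω → ℝ}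

lemma sum_integral_mul_sub_mul_sq (hx : ∀ k, MemLp (x k) 2 μ) (hy : ∀ k, MemLp (y k) 2 μ)
    (α β : ℝ) :
    ∑ k, ∫ ω, (α * x k ω - β * y k ω) ^ 2 ∂μ =
      α ^ 2 * ∑ k, ∫ ω, x k ω ^ 2 ∂μ - 2 * α * β * ∑ k, ∫ ω, x k ω * y k ω ∂μ +
        β ^ 2 * ∑ k, ∫ ω, y k ω ^ 2 ∂μ := by
  simp only [Finset.mul_sum, ← Finset.sum_sub_distrib, ← Finset.sum_add_distrib]
  refine Finset.sum_congr rfl fun k _ => ?_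
  have hxx := (hx k).integrable_sq
  have hyy := (hy k).integrable_sq
  have hxy : Integrable (fun ω => x k ω * y k ω) μ := (hx k).integrable_mul (hy k)
  have hexpand : ∀ ω, (α * x k ω - β * y k ω) ^ 2 =
      α ^ 2 * x k ω ^ 2 - 2 * α * β * (x k ω * y k ω) + β ^ 2 * y k ω ^ 2 := fun ω => by ring
  simp_rw [hexpand]
  rw [integral_add (by exact (hxx.const_mul _).sub (hxy.const_mul _)) (hyy.const_mul _),
    integral_sub (hxx.const_mul _) (hxy.const_mul _), integral_const_mul, integral_const_mul,
    integral_const_mul]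

lemma exists_correlation (hx : ∀ k, MemLp (x k) 2 μ) (hy : ∀ k, MemLp (y k) 2 μ) {T : ℝ}
    (hxT : ∑ k, ∫ ω, x k ω ^ 2 ∂μ ≤ T) (hyT : ∑ k, ∫ ω, y k ω ^ 2 ∂μ ≤ T) :
    ∃ ρ : ℝ, |ρ| ≤ 1 ∧ ∀ α β : ℝ, ∑ k, ∫ ω, (α * x k ω - β * y k ω) ^ 2 ∂μ ≤
      T * (α ^ 2 - 2 * α * β * ρ + β ^ 2) := by
  set S := ∑ k, ∫ ω, x k ω * y k ω ∂μ
  have hnonneg : ∀ α β : ℝ, 0 ≤ ∑ k, ∫ ω, (α * x k ω - β * y k ω) ^ 2 ∂μ := fun α β =>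
    Finset.sum_nonneg fun k _ => integral_nonneg fun ω => sq_nonneg _
  have hT : 0 ≤ T :=
    (Finset.sum_nonneg fun k _ => integral_nonneg fun ω => sq_nonneg (x k ω)).trans hxT
  have hS : |S| ≤ T := by
    have hsub := hnonneg 1 1
    have hadd := hnonneg 1 (-1)
    rw [sum_integral_mul_sub_mul_sq hx hy] at hsub hadd
    rw [abs_le]
    constructor <;> linarith
  have hTS : T * (S / T) = S :=
    mul_div_cancel_of_imp' fun h => abs_nonpos_iff.1 (hS.trans_eq h)
  refine ⟨S / T, ?_, fun α β => ?_⟩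
  · rw [abs_div, abs_of_nonneg hT]
    exact div_le_one_of_le₀ hS hT
  · calc ∑ k, ∫ ω, (α * x k ω - β * y k ω) ^ 2 ∂μ
        ≤ α ^ 2 * T - 2 * α * β * S + β ^ 2 * T := by
          rw [sum_integral_mul_sub_mul_sq hx hy]
          gcongr
      _ = T * (α ^ 2 - 2 * α * β * (S / T) + β ^ 2) := by
          linear_combination (2 * α * β) * hTS

end Correlation

namespace ICCode

variable {N : ℕ} {c : ICCode N} {P : ℝ}

lemma PowerLE.memLp_input (h : c.PowerLE P) (i : Fin 2) (k : Fin N) :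
    MemLp (c.input i k) 2 c.prob := by
  refine memLp_two_of_lintegral_sq_ne_top (c.measurable_input i k) (ne_top_of_le_ne_top
    ENNReal.ofReal_ne_top (le_trans ?_ (h i)))
  exact Finset.single_le_sum (f := fun k => ∫⁻ ω, ENNReal.ofReal (c.input i k ω ^ 2) ∂c.prob)
    (fun _ _ => zero_le) (Finset.mem_univ k)

lemma PowerLE.sum_integral_sq_le (hP : 0 ≤ P) (h : c.PowerLE P) (i : Fin 2) :
    ∑ k, ∫ ω, c.input i k ω ^ 2 ∂c.prob ≤ N * P := by
  have hofReal : ∀ k, ∫⁻ ω, ENNReal.ofReal (c.input i k ω ^ 2) ∂c.prob =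
      ENNReal.ofReal (∫ ω, c.input i k ω ^ 2 ∂c.prob) := fun k =>
    (ofReal_integral_eq_lintegral_ofReal (h.memLp_input i k).integrable_sq
      (ae_of_all _ fun ω => sq_nonneg _)).symm
  have hpower := h i
  simp_rw [hofReal] at hpower
  rw [← ENNReal.ofReal_sum_of_nonneg fun k _ => integral_nonneg fun ω => sq_nonneg _] at hpower
  exact (ENNReal.ofReal_le_ofReal_iff (by positivity)).1 hpower

end ICCode

section ResidualVariance

/-- The argument of the logarithm in the outer bound: the variance left after the linear estimation
of `hd x₁ + z₁` from `hd x₂ + hc x₁ + z₂`, for inputs of power `P` and correlation coefficient `±ρ`,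
where `S = hd² P` and `I = hc² P`. -/
noncomputable def residualVariance (S I ρ : ℝ) : ℝ :=
  1 + (S + S ^ 2 * (1 - ρ ^ 2)) / (1 + S + I + 2 * ρ * Real.sqrt (S * I))

variable {S I ρ : ℝ}

lemma residualVariance_den_pos (hS : 0 ≤ S) (hI : 0 ≤ I) (hρ : |ρ| ≤ 1) :
    0 < 1 + S + I + 2 * ρ * Real.sqrt (S * I) := by
  have hamgm : 2 * Real.sqrt (S * I) ≤ S + I := by
    rw [Real.sqrt_mul hS]
    linarith [two_mul_le_add_sq √S √I, Real.sq_sqrt hS, Real.sq_sqrt hI]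
  have hρsqrt : -Real.sqrt (S * I) ≤ ρ * Real.sqrt (S * I) := by
    nlinarith [(abs_le.1 hρ).1, Real.sqrt_nonneg (S * I)]
  linarith

lemma one_le_residualVariance (hS : 0 ≤ S) (hI : 0 ≤ I) (hρ : |ρ| ≤ 1) :
    1 ≤ residualVariance S I ρ := by
  have hρ' : 0 ≤ 1 - ρ ^ 2 := sub_nonneg.2 ((sq_le_one_iff_abs_le_one ρ).2 hρ)
  exact le_add_of_nonneg_right (div_nonneg (by positivity) (residualVariance_den_pos hS hI hρ).le)

lemma continuousOn_residualVariance (hS : 0 ≤ S) (hI : 0 ≤ I) :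
    ContinuousOn (residualVariance S I) {ρ | |ρ| ≤ 1} :=
  continuousOn_const.add (ContinuousOn.div (by fun_prop) (by fun_prop)
    fun _ hρ => (residualVariance_den_pos hS hI hρ).ne')

lemma exists_isGreatest_outerBound (hS : 0 ≤ S) (hI : 0 ≤ I) (CG : ℝ) :
    ∃ B, IsGreatest ((fun ρ => 2 * CG + 1 / 2 * Real.logb 2 (residualVariance S I ρ)) ''
      {ρ : ℝ | |ρ| ≤ 1}) B := by
  have hcompact : IsCompact {ρ : ℝ | |ρ| ≤ 1} := by
    simp only [abs_le]
    exact isCompact_Icc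
  refine (hcompact.image_of_continuousOn ?_).exists_isGreatest (.image _ ⟨0, by simp⟩)
  refine continuousOn_const.add (continuousOn_const.mul (ContinuousOn.div_const ?_ _))
  exact (continuousOn_residualVariance hS hI).log fun _ hρ =>
    (zero_lt_one.trans_le (one_le_residualVariance hS hI hρ)).ne'

lemma exists_linear_estimator {P : ℝ} (hP : 0 ≤ P) (hd hc : ℝ) {ρ : ℝ} (hρ : |ρ| ≤ 1) :
    ∃ a ρ' : ℝ, |ρ'| ≤ 1 ∧
      P * ((hd - a * hc) ^ 2 - 2 * (hd - a * hc) * (a * hd) * ρ + (a * hd) ^ 2) =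
        residualVariance (hd ^ 2 * P) (hc ^ 2 * P) ρ' - 1 - a ^ 2 := by
  have hsqrt : Real.sqrt (hd ^ 2 * P * (hc ^ 2 * P)) = |hd * hc| * P := by
    rw [show hd ^ 2 * P * (hc ^ 2 * P) = (hd * hc * P) ^ 2 by ring, Real.sqrt_sq_eq_abs, abs_mul,
      abs_of_nonneg hP]
  obtain ⟨ρ', hρ', hsq, hsign⟩ : ∃ ρ' : ℝ, |ρ'| ≤ 1 ∧ ρ' ^ 2 = ρ ^ 2 ∧
      ρ' * |hd * hc| = ρ * (hd * hc) := by
    rcases le_total 0 (hd * hc) with h | h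
    · exact ⟨ρ, hρ, rfl, by rw [abs_of_nonneg h]⟩
    · exact ⟨-ρ, by rwa [abs_neg], neg_sq ρ, by rw [abs_of_nonpos h, neg_mul_neg]⟩
  set A := 1 + hd ^ 2 * P + hc ^ 2 * P + 2 * ρ * (hd * hc) * P with hA
  have hden : 1 + hd ^ 2 * P + hc ^ 2 * P + 2 * ρ' * Real.sqrt (hd ^ 2 * P * (hc ^ 2 * P)) = A := by
    rw [hsqrt]
    linear_combination 2 * P * hsign
  have hApos : A ≠ 0 := by
    rw [← hden]
    exact (residualVariance_den_pos (by positivity) (by positivity) hρ').ne'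
  -- With `b = P * hd * (hc + hd * ρ)`, the left-hand side is `hd² P - 2ab + a² A - a²`, and
  -- `hd² P - 2ab + a² A` is least at `a = b / A`.
  refine ⟨P * hd * (hc + hd * ρ) / A, ρ', hρ', ?_⟩
  rw [residualVariance, hden, hsq]
  field_simp
  rw [hA]
  ring

end ResidualVariance

lemma ICCode.exists_log_numMsg_mul_le {N : ℕ} (c : ICCode N) {CG P : ℝ} (hrate : c.CoopRateLE CG)
    (hP : 0 ≤ P) (hpow : c.PowerLE P) (hd hc : ℝ) (i : Fin 2) (hfin : c.leakage hd hc i ≠ ⊤) :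
    ∃ ρ : ℝ, |ρ| ≤ 1 ∧ Real.log (c.numMsg i) * (1 - c.errorProb hd hc i) ≤
      (c.leakage hd hc i).toReal + 1 + N * (2 * CG +
        1 / 2 * Real.logb 2 (residualVariance (hd ^ 2 * P) (hc ^ 2 * P) ρ)) * Real.log 2 := by
  obtain ⟨ρ, hρ, hmoment⟩ := exists_correlation (hpow.memLp_input i) (hpow.memLp_input i.rev)
    (hpow.sum_integral_sq_le hP i) (hpow.sum_integral_sq_le hP i.rev)
  obtain ⟨a, ρ', hρ', hvariance⟩ := exists_linear_estimator hP hd hc hρ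
  set v := residualVariance (hd ^ 2 * P) (hc ^ 2 * P) ρ'
  have hv : 1 ≤ v := one_le_residualVariance (by positivity) (by positivity) hρ'
  have hmse : ∑ k, ∫ ω, ((hd - a * hc) * c.input i k ω - a * hd * c.input i.rev k ω) ^ 2 ∂c.prob ≤
      N * (√v ^ 2 - 1 - a ^ 2) := by
    rw [Real.sq_sqrt (zero_le_one.trans hv), ← hvariance, ← mul_assoc]
    exact hmoment _ _
  have hbound := c.log_numMsg_mul_le hrate hd hc hpow.memLp_input i hfin
    (Real.one_le_sqrt.2 hv) hmse
  have hlogb : Real.logb 2 v * Real.log 2 = Real.log v :=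
    div_mul_cancel₀ _ (Real.log_pos one_lt_two).ne'
  refine ⟨ρ', hρ', hbound.trans_eq ?_⟩
  rw [Real.log_sqrt (zero_le_one.trans hv)]
  linear_combination -(N / 2) * hlogb

lemma IsAchievableSymmSecrecyRate.sub_mul_one_sub_le {hd hc P CG R B : ℝ} (hP : 0 ≤ P)
    (hR : IsAchievableSymmSecrecyRate hd hc P CG R)
    (hB : ∀ ρ : ℝ, |ρ| ≤ 1 →
      2 * CG + 1 / 2 * Real.logb 2 (residualVariance (hd ^ 2 * P) (hc ^ 2 * P) ρ) ≤ B)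
    {ε : ℝ} (hε : 0 < ε) (hε1 : ε < 1) :
    (R - ε) * (1 - ε) ≤ B + 2 / Real.log 2 * ε := by
  have hlog2 : 0 < Real.log 2 := Real.log_pos one_lt_two
  have hlarge : ∀ᶠ N : ℕ in atTop, 1 ≤ N * ε :=
    (tendsto_natCast_atTop_atTop.atTop_mul_const hε).eventually_ge_atTop 1
  obtain ⟨N, ⟨c, hrate, hpow, hcode⟩, hN⟩ := ((hR ε hε).and hlarge).exists
  have hNpos : (0 : ℝ) < N := pos_of_mul_pos_left (one_pos.trans_le hN) hε.le
  obtain ⟨hnumMsg, herror, hleakage⟩ := hcode 0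
  obtain ⟨ρ, hρ, hbound⟩ := c.exists_log_numMsg_mul_le hrate hP hpow hd hc 0
    (ne_top_of_le_ne_top ENNReal.ofReal_ne_top hleakage)
  have hlogM : (R - ε) * (N * Real.log 2) ≤ Real.log (c.numMsg 0) := by
    rw [le_div_iff₀ hNpos, Real.logb, le_div_iff₀ hlog2] at hnumMsg
    linarith
  have hchain : (R - ε) * (1 - ε) * (N * Real.log 2) ≤
      (B + 2 / Real.log 2 * ε) * (N * Real.log 2) :=
    calc (R - ε) * (1 - ε) * (N * Real.log 2)
        = (R - ε) * (N * Real.log 2) * (1 - ε) := mul_right_comm _ _ _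
      _ ≤ Real.log (c.numMsg 0) * (1 - ε) :=
          mul_le_mul_of_nonneg_right hlogM (by linarith)
      _ ≤ Real.log (c.numMsg 0) * (1 - c.errorProb hd hc 0) :=
          mul_le_mul_of_nonneg_left (by linarith) (Real.log_natCast_nonneg _)
      _ ≤ N * ε + N * ε + N * B * Real.log 2 := by
          have hleakage' := ENNReal.toReal_le_of_le_ofReal (by positivity) hleakage
          grw [hbound, hleakage', hB ρ hρ, hN]
      _ = (B + 2 / Real.log 2 * ε) * (N * Real.log 2) := by
          field_simp
          ring
  exact le_of_mul_le_mul_right hchain (by positivity)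

lemma le_of_forall_sub_mul_one_sub_le {R B C : ℝ}
    (h : ∀ ε ∈ Set.Ioo (0 : ℝ) 1, (R - ε) * (1 - ε) ≤ B + C * ε) : R ≤ B := by
  have hleft : Tendsto (fun ε : ℝ => (R - ε) * (1 - ε)) (nhdsWithin 0 (Set.Ioi 0)) (nhds R) :=
    tendsto_nhdsWithin_of_tendsto_nhds (Continuous.tendsto' (by fun_prop) _ _ (by simp))
  have hright : Tendsto (fun ε : ℝ => B + C * ε) (nhdsWithin 0 (Set.Ioi 0)) (nhds B) :=
    tendsto_nhdsWithin_of_tendsto_nhds (Continuous.tendsto' (by fun_prop) _ _ (by simp))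
  exact le_of_tendsto_of_tendsto hleft hright
    (eventually_of_mem (Ioo_mem_nhdsGT one_pos) h)

theorem theorem8 (hd hc P CG SNR INR : ℝ) (hP : 0 ≤ P) (hCG : 0 ≤ CG)
    (hSNR : SNR = hd ^ 2 * P) (hINR : INR = hc ^ 2 * P) :
    ∃ B : ℝ,
      IsGreatest
        ((fun ρ : ℝ => 2 * CG + 1 / 2 * Real.logb 2
          (1 + (SNR + SNR ^ 2 * (1 - ρ ^ 2)) /
            (1 + SNR + INR + 2 * ρ * Real.sqrt (SNR * INR)))) '' {ρ : ℝ | |ρ| ≤ 1}) B ∧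
      ∀ R : ℝ, IsAchievableSymmSecrecyRate hd hc P CG R → R ≤ B := by
  subst hSNR hINR
  obtain ⟨B, hB⟩ := exists_isGreatest_outerBound (S := hd ^ 2 * P) (I := hc ^ 2 * P)
    (by positivity) (by positivity) CG
  refine ⟨B, hB, fun R hR => ?_⟩
  refine le_of_forall_sub_mul_one_sub_le (C := 2 / Real.log 2) fun ε hε => ?_
  exact hR.sub_mul_one_sub_le hP (fun ρ hρ => hB.2 (Set.mem_image_of_mem _ hρ)) hε.1 hε.2
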